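/- Let $\hat{\mathbb C}=\mathbb C\cup\{\infty\}$. Let $R_0(w)$ be a complex polynomial of degree $d$ all of whose zeros are simple, and let $P(z,w)$ be a complex polynomial of total degree at most $d$, written (uniquely) as $$P(z,w)=\sum_{j=0}^{d}P_j(w)\,(w-z)^{d-j},\qquad \deg P_j\le j .$$ Assume that $P\not\equiv 0$ and that, for the minimal $j$ with $P_j\not\equiv 0$, one has $j<d$ and the polynomial $P_j$ is not constant. For $\delta\in\mathbb C$ put $R_\delta(z,w)=R_0(w)+\delta P(z,w)$, let $\Gamma_\delta$ be the closure in $\hat{\mathbb C}\times\hat{\mathbb C}$ of the curve $\{(z,w)\in\mathbb C^2: R_\delta(z,w)=0\}$, and let $F_\delta(z)=\{w:(z,w)\in\Gamma_\delta\}$ be the associated holomorphic correspondence $F_\delta:z\to w$. For $\delta$ of small absolute value $\deg_w R_\delta=d$ and every $F_\delta(z)$, $z\in\hat{\mathbb C}$, consists of $d$ points counted with multiplicity: for $z\in\mathbb C$ they are the zeros of $w\mapsto R_\delta(z,w)$, and for $z=\infty$ they are the zeros of the coefficient (a polynomial in $w$) of the highest power of $z$ in $R_\delta$, together with $\infty$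 taken as many times as is needed to make $d$ points in all. For a finite Borel measure $\nu$ on $\hat{\mathbb C}$ the push-forward $(F_\delta)_*\nu$ is the measure $B\mapsto\int \#\big(F_\delta(z)\cap B\big)\,d\nu(z)$, with points counted with multiplicity, so that $(F_\delta)_*\delta_a=\sum_{w\in F_\delta(a)}\delta_w$, where $\delta_x$ denotes the Dirac measure at $x$; $(F_\delta^m)_*$ is the push-forward by the $m$-fold composition of $F_\delta$. Then for every $\epsilon>0$ there is $\Delta>0$ such that for every $\delta\in\mathbb C$ with $|\delta|<\Delta$ there is a regular Borel probability measure $\mu_{F_\delta}$ on $\hat{\mathbb C}$ with the following properties: 1. $(F_\delta)_*\mu_{F_\delta}=d\,\mu_{F_\delta}$; 2. for every $a\in\hat{\mathbb C}$, including $a=\infty$, $\ d^{-m}(F_\delta^m)_*\delta_a\to\mu_{F_\delta}$ in the weak-* topology as $m\to\infty$; 3. $\operatorname{supp}\mu_{F_\delta}$ is contained in the $\epsilon$-neighborhood (in $\mathbb C$) of the set of zeros of $R_0$; 4. $\operatorname{supp}\mu_{F_\delta}$ is the minimal closed forward invariant set: it is non-empty, closed and forward invariant under $F_\delta$ (a set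 $S$ is forward invariant if $F_\delta(S)\subset S$), and it is contained in every non-empty closed forward invariant subset of $\hat{\mathbb C}$. -/

import Mathlib

open MeasureTheory Filter Topology

noncomputable section

namespace HolCorr

/-- The Riemann sphere, as the one-point compactification of the complex plane. -/
abbrev Sphere : Type := OnePoint ℂ

/-- The Borel sigma-algebra of the Riemann sphere. -/
instance instMeasurableSpaceSphere : MeasurableSpace Sphere := borel Sphere

instance instBorelSpaceSphere : BorelSpace Sphere := ⟨rfl⟩

/-! Bivariate polynomials are elements of `MvPolynomial (Fin 2) ℂ`; the variable `0` is `z` and the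
variable `1` is `w`. -/

/-- The algebraic curve on `Sphere × Sphere` defined by `R(z, w)`: the closure of the affine curve
`R(z, w) = 0`. -/
def curve (R : MvPolynomial (Fin 2) ℂ) : Set (Sphere × Sphere) :=
  closure {p | ∃ z w : ℂ, MvPolynomial.eval ![z, w] R = 0 ∧ p = ((z : Sphere), (w : Sphere))}

/-- The multivalued map `F : z → w` of the correspondence defined by `R`, as a set-valued map. -/
def image (R : MvPolynomial (Fin 2) ℂ) (a : Sphere) : Set Sphere :=
  {b | (a, b) ∈ curve R}

/-- `S` is forward invariant: `F(S) ⊆ S`. -/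
def ForwardInvariant (R : MvPolynomial (Fin 2) ℂ) (S : Set Sphere) : Prop :=
  ∀ a ∈ S, image R a ⊆ S

/-- The equation, in `w`, of the intersection of the curve with the line `z = a`. For finite `a` it
is `R(a, w)`; for `a = ∞` it is the coefficient in `ℂ[w]` of the highest power of `z` in `R`. -/
def fibre (R : MvPolynomial (Fin 2) ℂ) : Sphere → Polynomial ℂ
  | OnePoint.infty =>
      (MvPolynomial.aeval ![Polynomial.X, Polynomial.C Polynomial.X] R :
        Polynomial (Polynomial ℂ)).leadingCoeff
  | OnePoint.some a => MvPolynomial.aeval ![Polynomial.C a, Polynomial.X] R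

/-- The points of `F(a)` counted with multiplicity, for a curve that does not contain the line
`z = a` (that is, `fibre R a ≠ 0`): the zeros of the fibre polynomial with their multiplicities, and
the point `∞` with multiplicity `deg_w R - deg (fibre R a)`. There are `deg_w R` of them. -/
def images (R : MvPolynomial (Fin 2) ℂ) (a : Sphere) : Multiset Sphere :=
  (fibre R a).roots.map (fun w : ℂ => (w : Sphere)) +
    Multiset.replicate (MvPolynomial.degreeOf 1 R - (fibre R a).natDegree) OnePoint.infty

/-- The `m`-fold composition `F^m` of a correspondence, given by its images with multiplicity. -/
def iter (F : Sphere → Multiset Sphere) : ℕ → Sphere → Multiset Sphere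
  | 0, a => {a}
  | m + 1, a => (iter F m a).bind F

/-- The sum of the Dirac measures at the points of a finite multiset. -/
def diracSum (s : Multiset Sphere) : Measure Sphere :=
  (s.map Measure.dirac).sum

/-- The push-forward `F_* μ` of a measure `μ` by a correspondence `F` given by its images with
multiplicity: `(F_* μ)(B) = ∫ #(F(a) ∩ B) dμ(a)`, so that `F_* δ_a` is the sum of the Dirac measures
at the points of `F(a)`. -/
def pushforward (F : Sphere → Multiset Sphere) (μ : Measure Sphere) : Measure Sphere :=
  μ.bind (fun a => diracSum (F a))

/-- `R_δ(z, w) = R₀(w) + δ P(z, w)`. -/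
def perturb (R₀ : Polynomial ℂ) (P : MvPolynomial (Fin 2) ℂ) (δ : ℂ) : MvPolynomial (Fin 2) ℂ :=
  Polynomial.aeval (MvPolynomial.X 1) R₀ + MvPolynomial.C δ * P

/-- Weak-* convergence of a sequence of measures on the sphere, tested on `C(Sphere, ℂ)`. -/
def WeakStarTendsto (ν : ℕ → Measure Sphere) (μ : Measure Sphere) : Prop :=
  ∀ φ : C(Sphere, ℂ), Tendsto (fun m => ∫ x, φ x ∂(ν m)) atTop (𝓝 (∫ x, φ x ∂μ))

end HolCorr

end

/-!
For small `δ` and over a large closed disc `K`, the zeros of `R_δ(z, ·)` form `d` branches, each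
mapping `K` into a small disc around a zero of `R₀` and contracting by `1/2`. The averaging operator
of these branches makes the oscillation over `K` of any continuous function tend to `0`, which
yields Hutchinson's invariant measure on `K`.

It remains to see that every point of the sphere outside `K` has an image in `K`. Let `n = deg_z P`,
and let `q` be the coefficient of `z^n` in `P`. For large `z`, the coefficients of `R_δ(z, ·)`
differ from those of `R₀ + δ z^n q` by little relative to `|δ z^n|`. No nontrivial combination of
`R₀` and `q` is constant, so by compactness every member of the pencil they span has a zero within a
bounded distance of `0`, and so do its small perturbations. Hence under iteration the proportion of
mass outside `K` is at most `(1 - 1/d)^m`, and the convergence seen on `K` holds for every starting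
point. If `P` is expanded in powers of `w - z`, then `q` is, up to sign, the first nonzero `P_j`.
-/

noncomputable section

namespace HolCorr

section Average

variable {X Y E : Type*} [NormedAddCommGroup E] [NormedSpace ℝ E]

/-- The averaging operator of a multivalued map `F`, whose values are finite multisets: it sends a
function `φ` to the function whose value at `a` is the mean of `φ` over `F a`. -/
def average (F : X → Multiset X) (φ : X → E) (a : X) : E :=
  ((F a).card : ℝ)⁻¹ • ((F a).map φ).sum

lemma average_sub_const {F : X → Multiset X} {a : X} (ha : F a ≠ 0) (φ : X → E) (c : E) :
    average F φ a - c = average F (fun b => φ b - c) a := by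
  have hcard : ((F a).card : ℝ) ≠ 0 := by simpa using ha
  rw [average, average, Multiset.sum_map_sub, smul_sub, Multiset.map_const', Multiset.sum_replicate,
    ← Nat.cast_smul_eq_nsmul ℝ, inv_smul_smul₀ hcard]

lemma norm_average_le_average_norm (F : X → Multiset X) (φ : X → E) (a : X) :
    ‖average F φ a‖ ≤ average F (fun b => ‖φ b‖) a := by
  rw [average, average, norm_smul, norm_inv, Real.norm_natCast, smul_eq_mul]
  gcongr
  simpa only [Multiset.map_map, Function.comp_def] using norm_multiset_sum_le ((F a).map φ)

lemma norm_average_sub_le_of_mem {F : X → Multiset X} {φ : X → E} {c : E} {r B : ℝ} {a b : X}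
    (hb : b ∈ F a) (hr : ‖φ b - c‖ ≤ r) (hB : ∀ x ∈ F a, ‖φ x - c‖ ≤ B) :
    ‖average F φ a - c‖ ≤ ((F a).card : ℝ)⁻¹ * r + (1 - ((F a).card : ℝ)⁻¹) * B := by
  obtain ⟨s, hs⟩ := Multiset.exists_cons_of_mem hb
  have hsum : (s.map fun x => ‖φ x - c‖).sum ≤ s.card * B := by
    simpa using Multiset.sum_le_card_nsmul (s.map fun x => ‖φ x - c‖) B
      (by simpa using fun x hx => hB x (hs ▸ Multiset.mem_cons_of_mem hx))
  rw [average_sub_const (by simp [hs])]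
  refine (norm_average_le_average_norm F _ a).trans ?_
  simp only [average, hs, Multiset.map_cons, Multiset.sum_cons, Multiset.card_cons, smul_eq_mul]
  push_cast
  calc ((s.card : ℝ) + 1)⁻¹ * (‖φ b - c‖ + (s.map fun x => ‖φ x - c‖).sum)
      ≤ ((s.card : ℝ) + 1)⁻¹ * (r + s.card * B) := by gcongr
    _ = _ := by field_simp; ring

lemma norm_average_sub_le {F : X → Multiset X} {φ : X → E} {c : E} {r : ℝ} {a : X}
    (ha : F a ≠ 0) (hr : ∀ b ∈ F a, ‖φ b - c‖ ≤ r) : ‖average F φ a - c‖ ≤ r := by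
  obtain ⟨b, hb⟩ := Multiset.exists_mem_of_ne_zero ha
  refine (norm_average_sub_le_of_mem hb (hr b hb) hr).trans_eq ?_
  ring

lemma norm_iterate_average_sub_le {F : X → Multiset X} {S : Set X} (hF : ∀ a ∈ S, F a ≠ 0)
    (hS : ∀ a ∈ S, ∀ b ∈ F a, b ∈ S) {φ : X → E} {c : E} {r : ℝ}
    (hφ : ∀ a ∈ S, ‖φ a - c‖ ≤ r) (n : ℕ) : ∀ a ∈ S, ‖(average F)^[n] φ a - c‖ ≤ r := by
  induction n with
  | zero => exact hφ
  | succ n ih =>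
    intro a ha
    rw [Function.iterate_succ_apply']
    exact norm_average_sub_le (hF a ha) fun b hb => ih b (hS a ha b hb)

/-- At each step, at least a proportion `1 / d` of the remaining mass falls into the absorbing
set `S`. -/
lemma norm_iterate_average_sub_le_of_absorbing {F : X → Multiset X} {d : ℕ}
    (hd : ∀ a, (F a).card = d) {S : Set X} (hS : ∀ a ∈ S, ∀ b ∈ F a, b ∈ S)
    (habs : ∀ a, ∃ b ∈ F a, b ∈ S) {φ : X → E} {c : E} {r C : ℝ}
    (hr : ∀ a ∈ S, ‖φ a - c‖ ≤ r) (hC : ∀ a, ‖φ a - c‖ ≤ r + C) (n : ℕ) (a : X) :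
    ‖(average F)^[n] φ a - c‖ ≤ r + (1 - (d : ℝ)⁻¹) ^ n * C := by
  have hne : ∀ a, F a ≠ 0 := fun a h => by simpa [h] using habs a
  induction n generalizing a with
  | zero => simpa using hC a
  | succ n ih =>
    obtain ⟨b, hb, hbS⟩ := habs a
    rw [Function.iterate_succ_apply']
    refine (norm_average_sub_le_of_mem hb
      (norm_iterate_average_sub_le (fun a _ => hne a) hS hr n b hbS) fun x _ => ih x).trans_eq ?_
    rw [hd]
    ring

lemma average_comp_of_semiconj {F : X → Multiset X} {G : Y → Multiset Y} {e : Y → X}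
    (h : ∀ y, F (e y) = (G y).map e) (φ : X → E) : average F φ ∘ e = average G (φ ∘ e) := by
  funext y
  simp only [Function.comp_apply, average, h, Multiset.card_map, Multiset.map_map]

lemma iterate_average_comp_of_semiconj {F : X → Multiset X} {G : Y → Multiset Y} {e : Y → X}
    (h : ∀ y, F (e y) = (G y).map e) (n : ℕ) (φ : X → E) :
    (average F)^[n] φ ∘ e = (average G)^[n] (φ ∘ e) :=
  (show Function.Semiconj (fun ψ : X → E => ψ ∘ e) (average F) (average G) from
    average_comp_of_semiconj h).iterate_right n φ

end Average

lemma integrable_of_continuous_of_compactSpace {X E : Type*} [MeasurableSpace X]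
    [TopologicalSpace X] [BorelSpace X] [CompactSpace X] [NormedAddCommGroup E] (μ : Measure X)
    [IsFiniteMeasure μ] {φ : X → E} (hφ : Continuous φ) : Integrable φ μ :=
  hφ.integrable_of_hasCompactSupport (HasCompactSupport.of_compactSpace φ)

section IteratedFunctionSystem

variable {ι X E : Type*} [Fintype ι] [NormedAddCommGroup E] [NormedSpace ℝ E]

/-- The multivalued map whose branches are the maps `f i`. -/
def branches (f : ι → X → X) (x : X) : Multiset X := Finset.univ.val.map fun i => f i x

@[simp]
lemma mem_branches {f : ι → X → X} {x y : X} : y ∈ branches f x ↔ ∃ i, f i x = y := by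
  simp [branches]

@[simp]
lemma card_branches (f : ι → X → X) (x : X) : (branches f x).card = Fintype.card ι := by
  simp [branches]

lemma branches_ne_zero [Nonempty ι] (f : ι → X → X) (x : X) : branches f x ≠ 0 := by
  simp [← Multiset.card_eq_zero]

lemma average_branches (f : ι → X → X) (φ : X → E) (x : X) :
    average (branches f) φ x = (Fintype.card ι : ℝ)⁻¹ • ∑ i, φ (f i x) := by
  simp [average, branches, Finset.sum_map_val]

lemma continuous_average_branches [TopologicalSpace X] {f : ι → X → X}
    (hf : ∀ i, Continuous (f i)) {φ : X → E} (hφ : Continuous φ) :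
    Continuous (average (branches f) φ) := by
  simp only [funext (average_branches f φ)]
  exact (continuous_finsetSum _ fun i _ => hφ.comp (hf i)).const_smul _

lemma continuous_iterate_average_branches [TopologicalSpace X] {f : ι → X → X}
    (hf : ∀ i, Continuous (f i)) {φ : X → E} (hφ : Continuous φ) (n : ℕ) :
    Continuous ((average (branches f))^[n] φ) :=
  Function.Iterate.rec (fun ψ : X → E => Continuous ψ) hφ
    (fun _ => continuous_average_branches hf) n

section Oscillation

variable [PseudoMetricSpace X] {f : ι → X → X} {κ : NNReal}

lemma norm_iterate_average_branches_sub_le (hf : ∀ i, LipschitzWith κ (f i)) {φ : X → E} {η r : ℝ}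
    (hr : 0 ≤ r) (hφ : ∀ x y, dist x y < η → ‖φ x - φ y‖ ≤ r) (n : ℕ) (x y : X)
    (hxy : κ ^ n * dist x y < η) :
    ‖(average (branches f))^[n] φ x - (average (branches f))^[n] φ y‖ ≤ r := by
  induction n generalizing x y with
  | zero => exact hφ x y (by simpa using hxy)
  | succ n ih =>
    have hstep : ∀ i, ‖(average (branches f))^[n] φ (f i x) -
        (average (branches f))^[n] φ (f i y)‖ ≤ r := fun i => ih _ _ <| by
      calc (κ : ℝ) ^ n * dist (f i x) (f i y) ≤ κ ^ n * (κ * dist x y) := by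
            gcongr; exact (hf i).dist_le_mul x y
        _ < η := by rwa [← mul_assoc, ← pow_succ]
    rw [Function.iterate_succ_apply', average_branches, average_branches, ← smul_sub,
      ← Finset.sum_sub_distrib, norm_smul, norm_inv, Real.norm_natCast]
    calc (Fintype.card ι : ℝ)⁻¹ * ‖∑ i, ((average (branches f))^[n] φ (f i x) -
          (average (branches f))^[n] φ (f i y))‖
        ≤ (Fintype.card ι : ℝ)⁻¹ * ∑ _i : ι, r := by
          gcongr; exact norm_sum_le_of_le _ fun i _ => hstep i
      _ = (Fintype.card ι : ℝ)⁻¹ * Fintype.card ι * r := by simp [mul_assoc]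
      _ ≤ r := mul_le_of_le_one_left hr inv_mul_le_one

lemma eventually_norm_iterate_average_branches_sub_le [CompactSpace X] (hκ : κ < 1)
    (hf : ∀ i, LipschitzWith κ (f i)) {φ : X → E} (hφ : Continuous φ) {r : ℝ} (hr : 0 < r) :
    ∀ᶠ n in atTop, ∀ x y,
      ‖(average (branches f))^[n] φ x - (average (branches f))^[n] φ y‖ ≤ r := by
  obtain ⟨η, hη, hη'⟩ := Metric.uniformContinuous_iff.1
    (CompactSpace.uniformContinuous_of_continuous hφ) r hr
  obtain ⟨D, hD⟩ := Metric.isBounded_iff.1 (isCompact_univ (X := X)).isBounded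
  have hlim : Tendsto (fun n => (κ : ℝ) ^ n * D) atTop (𝓝 0) := by
    simpa using (tendsto_pow_atTop_nhds_zero_of_lt_one κ.coe_nonneg hκ).mul_const D
  filter_upwards [hlim.eventually_lt_const hη] with n hn x y
  refine norm_iterate_average_branches_sub_le hf hr.le
    (fun x y hxy => (dist_eq_norm (φ x) (φ y)).symm.trans_le (hη' hxy).le) n x y (hn.trans_le' ?_)
  gcongr
  exact hD (Set.mem_univ x) (Set.mem_univ y)

lemma tendsto_iterate_average_average_sub [Nonempty ι] [CompactSpace X] (hκ : κ < 1)
    (hf : ∀ i, LipschitzWith κ (f i)) {φ : X → E} (hφ : Continuous φ) (x : X) :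
    Tendsto (fun n => (average (branches f))^[n] (average (branches f) φ) x -
      (average (branches f))^[n] φ x) atTop (𝓝 0) := by
  refine Metric.tendsto_nhds.2 fun r hr => ?_
  filter_upwards [eventually_norm_iterate_average_branches_sub_le hκ hf hφ (half_pos hr)]
    with n hn
  rw [dist_zero_right, ← Function.iterate_succ_apply, Function.iterate_succ_apply']
  exact (norm_average_sub_le (branches_ne_zero f x) fun b _ => hn b x).trans_lt (half_lt_self hr)

end Oscillation

section Measure

variable [MeasurableSpace X] {f : ι → X → X}

/-- The averaging operator of a finite family of self-maps on measures, dual to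
`average (branches f)`; its fixed points are the invariant measures of the family. -/
def averageMeasure (f : ι → X → X) (μ : Measure X) : Measure X :=
  (Fintype.card ι : ENNReal)⁻¹ • ∑ i, μ.map (f i)

lemma nonempty_of_averageMeasure_eq {μ : Measure X} [NeZero μ] (hμ : averageMeasure f μ = μ) :
    Nonempty ι := by
  by_contra hι
  have := not_nonempty_iff.1 hι
  exact NeZero.ne μ (by simpa [averageMeasure] using hμ.symm)

variable [TopologicalSpace X] [BorelSpace X]

lemma averageMeasure_apply (hf : ∀ i, Continuous (f i)) (μ : Measure X) {s : Set X}
    (hs : MeasurableSet s) :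
    averageMeasure f μ s = (Fintype.card ι : ENNReal)⁻¹ * ∑ i, μ (f i ⁻¹' s) := by
  simp only [averageMeasure, Measure.smul_apply, Measure.finsetSum_apply, smul_eq_mul,
    Measure.map_apply (hf _).measurable hs]

lemma isProbabilityMeasure_averageMeasure [Nonempty ι] (hf : ∀ i, Continuous (f i))
    (μ : Measure X) [IsProbabilityMeasure μ] : IsProbabilityMeasure (averageMeasure f μ) := by
  constructor
  rw [averageMeasure_apply hf μ MeasurableSet.univ]
  simpa using ENNReal.inv_mul_cancel (a := Fintype.card ι) (by simp) (by simp)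

lemma integral_averageMeasure [CompactSpace X] (hf : ∀ i, Continuous (f i)) (μ : Measure X)
    [IsFiniteMeasure μ] {φ : X → E} (hφ : Continuous φ) :
    ∫ x, φ x ∂(averageMeasure f μ) = ∫ x, average (branches f) φ x ∂μ := by
  have hmap : ∀ i, ∫ x, φ x ∂(μ.map (f i)) = ∫ x, φ (f i x) ∂μ := fun i =>
    integral_map (hf i).measurable.aemeasurable
      (integrable_of_continuous_of_compactSpace _ hφ).aestronglyMeasurable
  simp only [averageMeasure, average_branches]
  rw [integral_smul_measure,
    integral_finsetSum_measure fun i _ => integrable_of_continuous_of_compactSpace _ hφ,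
    integral_smul, integral_finsetSum (f := fun i x => φ (f i x)) _
      fun i _ => integrable_of_continuous_of_compactSpace μ (hφ.comp (hf i))]
  simp [hmap]

lemma integral_iterate_average_branches_of_averageMeasure_eq [CompactSpace X]
    (hf : ∀ i, Continuous (f i)) {μ : Measure X} [IsFiniteMeasure μ] (hμ : averageMeasure f μ = μ)
    {φ : X → E} (hφ : Continuous φ) (n : ℕ) :
    ∫ x, (average (branches f))^[n] φ x ∂μ = ∫ x, φ x ∂μ := by
  induction n with
  | zero => rfl
  | succ n ih =>
    rw [← ih, Function.iterate_succ_apply',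
      ← integral_averageMeasure hf μ (continuous_iterate_average_branches hf hφ n), hμ]

/-- The operator `averageMeasure f` on probability measures. -/
def averageProbabilityMeasure [Nonempty ι] (hf : ∀ i, Continuous (f i))
    (μ : ProbabilityMeasure X) : ProbabilityMeasure X :=
  ⟨averageMeasure f μ, isProbabilityMeasure_averageMeasure hf μ⟩

lemma integral_iterate_averageProbabilityMeasure [Nonempty ι] [CompactSpace X]
    (hf : ∀ i, Continuous (f i)) (μ : ProbabilityMeasure X) (n : ℕ) {φ : X → E}
    (hφ : Continuous φ) :
    ∫ x, φ x ∂((averageProbabilityMeasure hf)^[n] μ : Measure X) =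
      ∫ x, (average (branches f))^[n] φ x ∂(μ : Measure X) := by
  induction n generalizing φ with
  | zero => rfl
  | succ n ih =>
    rw [Function.iterate_succ_apply', Function.iterate_succ_apply,
      ← ih (continuous_average_branches hf hφ)]
    exact integral_averageMeasure hf _ hφ

end Measure

section InvariantMeasure

variable [MeasurableSpace X] [MetricSpace X] [CompactSpace X] [BorelSpace X]
  {f : ι → X → X} {κ : NNReal}

theorem exists_averageMeasure_eq [Nonempty ι] [Nonempty X] (hκ : κ < 1)
    (hf : ∀ i, LipschitzWith κ (f i)) :
    ∃ μ : Measure X, IsProbabilityMeasure μ ∧ averageMeasure f μ = μ := by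
  have hc : ∀ i, Continuous (f i) := fun i => (hf i).continuous
  obtain ⟨x₀⟩ := ‹Nonempty X›
  let ν : ℕ → ProbabilityMeasure X := fun n =>
    (averageProbabilityMeasure hc)^[n] ⟨Measure.dirac x₀, inferInstance⟩
  have hν : ∀ n {φ : X → ℝ}, Continuous φ →
      ∫ x, φ x ∂(ν n : Measure X) = (average (branches f))^[n] φ x₀ := fun n φ hφ =>
    (integral_iterate_averageProbabilityMeasure hc _ n hφ).trans (integral_dirac _ _)
  obtain ⟨μ, hμ⟩ := exists_clusterPt_of_compactSpace (map ν atTop)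
  obtain ⟨U, hU, hlim⟩ := mapClusterPt_iff_ultrafilter.1 hμ
  have hlim' : ∀ {φ : X → ℝ}, Continuous φ →
      Tendsto (fun n => (average (branches f))^[n] φ x₀) U (𝓝 (∫ x, φ x ∂(μ : Measure X))) := by
    intro φ hφ
    simpa [hν _ hφ] using ProbabilityMeasure.tendsto_iff_forall_integral_tendsto.1 hlim
      (BoundedContinuousFunction.mkOfCompact ⟨φ, hφ⟩)
  have := isProbabilityMeasure_averageMeasure hc (μ : Measure X)
  refine ⟨μ, inferInstance, ext_of_forall_integral_eq_of_IsFiniteMeasure fun φ => ?_⟩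
  rw [integral_averageMeasure hc _ φ.continuous]
  refine tendsto_nhds_unique (hlim' (continuous_average_branches hc φ.continuous)) ?_
  simpa using ((tendsto_iterate_average_average_sub hκ hf φ.continuous x₀).mono_left hU).add
    (hlim' φ.continuous)

lemma eventually_norm_iterate_average_branches_sub_integral_le [CompleteSpace E] (hκ : κ < 1)
    (hf : ∀ i, LipschitzWith κ (f i)) {μ : Measure X} [IsProbabilityMeasure μ]
    (hμ : averageMeasure f μ = μ) {φ : X → E} (hφ : Continuous φ) {r : ℝ} (hr : 0 < r) :
    ∀ᶠ n in atTop, ∀ x, ‖(average (branches f))^[n] φ x - ∫ y, φ y ∂μ‖ ≤ r := by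
  have hc : ∀ i, Continuous (f i) := fun i => (hf i).continuous
  filter_upwards [eventually_norm_iterate_average_branches_sub_le hκ hf hφ hr] with n hn x
  have hint : Integrable ((average (branches f))^[n] φ) μ :=
    integrable_of_continuous_of_compactSpace μ (continuous_iterate_average_branches hc hφ n)
  rw [← integral_iterate_average_branches_of_averageMeasure_eq hc hμ hφ n]
  calc ‖(average (branches f))^[n] φ x - ∫ y, (average (branches f))^[n] φ y ∂μ‖
      = ‖∫ y, ((average (branches f))^[n] φ x - (average (branches f))^[n] φ y) ∂μ‖ := by
        rw [integral_sub (integrable_const _) hint]; simp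
    _ ≤ r * μ.real Set.univ := norm_integral_le_of_norm_le_const (ae_of_all _ (hn x))
    _ = r := by simp

end InvariantMeasure

end IteratedFunctionSystem

section Support

variable {X : Type*} [MeasurableSpace X] [TopologicalSpace X] [BorelSpace X]

lemma support_subset_of_forall_integral_eq_zero [CompactSpace X] [T2Space X] {μ : Measure X}
    [IsFiniteMeasure μ] {C : Set X} (hC : IsClosed C)
    (h : ∀ φ : C(X, ℝ), (∀ x ∈ C, φ x = 0) → ∫ x, φ x ∂μ = 0) : μ.support ⊆ C := by
  intro x hx
  by_contra hxC
  obtain ⟨φ, h0, h1, hφ⟩ := exists_continuous_zero_one_of_isClosed hC (isClosed_singleton (x := x))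
    (Set.disjoint_singleton_right.2 hxC)
  have hae := (integral_eq_zero_iff_of_nonneg (fun y => (hφ y).1)
    (integrable_of_continuous_of_compactSpace μ φ.continuous)).1 (h φ fun y hy => h0 hy)
  have hV : {y | φ y ≠ 0} ∈ 𝓝 x :=
    (isOpen_ne.preimage φ.continuous).mem_nhds (by simp [h1 rfl])
  exact ((Measure.mem_support_iff_forall x).1 hx _ hV).ne' hae

lemma support_map_of_isClosedEmbedding {Y : Type*} [TopologicalSpace Y] [MeasurableSpace Y]
    [BorelSpace Y] {e : X → Y} (he : IsClosedEmbedding e) (μ : Measure X) :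
    (μ.map e).support = e '' μ.support := by
  have hm := he.measurableEmbedding
  refine Set.Subset.antisymm ?_ ?_
  · have hrange : (μ.map e).support ⊆ Set.range e :=
      Measure.support_subset_of_isClosed he.isClosed_range (by simp [mem_ae_iff, hm.map_apply])
    intro y hy
    obtain ⟨x, rfl⟩ := hrange hy
    refine ⟨x, (Measure.mem_support_iff_forall x).2 fun V hV => ?_, rfl⟩
    obtain ⟨W, hW, hWV⟩ := (he.isInducing.nhds_eq_comap x ▸ hV : V ∈ comap e (𝓝 (e x)))
    have hpos := (Measure.mem_support_iff_forall _).1 hy W hW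
    rw [hm.map_apply] at hpos
    exact hpos.trans_le (measure_mono hWV)
  · rintro _ ⟨x, hx, rfl⟩
    refine (Measure.mem_support_iff_forall _).2 fun V hV => ?_
    rw [hm.map_apply]
    exact (Measure.mem_support_iff_forall x).1 hx _ (he.continuous.continuousAt hV)

variable {ι : Type*} [Fintype ι] {f : ι → X → X} {μ : Measure X}

lemma apply_mem_support_of_averageMeasure_eq (hf : ∀ i, Continuous (f i))
    (hμ : averageMeasure f μ = μ) {x : X} (hx : x ∈ μ.support) (i : ι) : f i x ∈ μ.support := by
  refine (Measure.mem_support_iff_forall _).2 fun V hV => ?_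
  obtain ⟨W, hWV, hW, hxW⟩ := mem_nhds_iff.1 hV
  have hpos : 0 < μ (f i ⁻¹' W) :=
    (Measure.mem_support_iff_forall x).1 hx _ ((hW.preimage (hf i)).mem_nhds hxW)
  refine lt_of_lt_of_le ?_ (measure_mono hWV)
  rw [← hμ, averageMeasure_apply hf μ hW.measurableSet]
  exact ENNReal.mul_pos (by simp) (hpos.trans_le (Finset.single_le_sum
    (f := fun i => μ (f i ⁻¹' W)) (fun _ _ => zero_le) (Finset.mem_univ i))).ne'

lemma support_subset_iUnion_range_of_averageMeasure_eq [CompactSpace X] [T2Space X]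
    (hf : ∀ i, Continuous (f i)) (hμ : averageMeasure f μ = μ) :
    μ.support ⊆ ⋃ i, Set.range (f i) := by
  have hclosed : IsClosed (⋃ i, Set.range (f i)) :=
    isClosed_iUnion_of_finite fun i => (isCompact_range (hf i)).isClosed
  refine Measure.support_subset_of_isClosed hclosed ?_
  rw [mem_ae_iff, ← hμ, averageMeasure_apply hf μ hclosed.measurableSet.compl]
  have hempty : ∀ i, f i ⁻¹' (⋃ k, Set.range (f k))ᶜ = ∅ := fun i =>
    Set.eq_empty_of_forall_notMem fun x hx => hx (Set.mem_iUnion.2 ⟨i, x, rfl⟩)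
  simp only [hempty, measure_empty, Finset.sum_const_zero, mul_zero]

/-- Averages over orbits that start in `C` do not see functions vanishing on `C`. -/
lemma support_subset_of_forall_apply_mem {X : Type*} [MeasurableSpace X] [MetricSpace X]
    [CompactSpace X] [BorelSpace X] {f : ι → X → X} {μ : Measure X} [IsProbabilityMeasure μ]
    {κ : NNReal} (hκ : κ < 1) (hf : ∀ i, LipschitzWith κ (f i)) (hμ : averageMeasure f μ = μ)
    {C : Set X} (hC : IsClosed C) (hne : C.Nonempty) (h : ∀ x ∈ C, ∀ i, f i x ∈ C) :
    μ.support ⊆ C := by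
  have := nonempty_of_averageMeasure_eq hμ
  obtain ⟨x₀, hx₀⟩ := hne
  refine support_subset_of_forall_integral_eq_zero hC fun φ hφ => ?_
  have hzero : ∀ n, (average (branches f))^[n] φ x₀ = 0 := fun n => by
    simpa using norm_iterate_average_sub_le (r := 0) (φ := φ) (c := 0) (F := branches f)
      (fun x _ => branches_ne_zero f x) (by simpa using h) (by simpa using hφ) n x₀ hx₀
  refine norm_le_zero_iff.1 (le_of_forall_pos_le_add fun r hr => ?_)
  obtain ⟨n, hn⟩ :=
    (eventually_norm_iterate_average_branches_sub_integral_le hκ hf hμ φ.continuous hr).exists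
  simpa [hzero] using hn x₀

end Support

section Branches

variable {ι K X E : Type*} [Fintype ι] [NormedAddCommGroup E] [NormedSpace ℝ E]

/-- `e : K → X` exhibits `K` as an absorbing set of the multivalued map `F`, on which `F` splits
into the branches `f i`: every value of `F` has as many points as there are branches, and at least
one of them lies in `K`. -/
structure HasBranches (F : X → Multiset X) (e : K → X) (f : ι → K → K) : Prop where
  apply_eq (x : K) : F (e x) = (branches f x).map e
  card_eq (a : X) : (F a).card = Fintype.card ι
  exists_mem (a : X) : ∃ x, e x ∈ F a

namespace HasBranches

variable {F : X → Multiset X} {e : K → X} {f : ι → K → K}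

lemma ne_zero (h : HasBranches F e f) (a : X) : F a ≠ 0 := fun ha => by
  simpa [ha] using h.exists_mem a

lemma nonempty [Nonempty X] (h : HasBranches F e f) : Nonempty ι := by
  obtain ⟨a⟩ := ‹Nonempty X›
  rw [← Fintype.card_pos_iff, ← h.card_eq a, Multiset.card_pos]
  exact h.ne_zero a

lemma mem_iff (h : HasBranches F e f) {x : K} {b : X} : b ∈ F (e x) ↔ ∃ i, e (f i x) = b := by
  simp [h.apply_eq]

lemma norm_iterate_average_sub_le (h : HasBranches F e f) {φ : X → E} {c : E} {r C : ℝ}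
    (hr : ∀ x, ‖φ (e x) - c‖ ≤ r) (hC : ∀ a, ‖φ a - c‖ ≤ r + C) (n : ℕ) (a : X) :
    ‖(average F)^[n] φ a - c‖ ≤ r + (1 - (Fintype.card ι : ℝ)⁻¹) ^ n * C := by
  refine norm_iterate_average_sub_le_of_absorbing h.card_eq (S := Set.range e) ?_
    (fun b => ?_) (by simpa using hr) hC n a
  · rintro _ ⟨x, rfl⟩ b hb
    obtain ⟨i, rfl⟩ := h.mem_iff.1 hb
    exact ⟨f i x, rfl⟩
  · obtain ⟨x, hx⟩ := h.exists_mem b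
    exact ⟨e x, hx, x, rfl⟩

theorem tendsto_iterate_average [MeasurableSpace K] [MetricSpace K] [CompactSpace K]
    [BorelSpace K] [CompleteSpace E] (h : HasBranches F e f) {κ : NNReal} (hκ : κ < 1)
    (hf : ∀ i, LipschitzWith κ (f i)) {μ : Measure K} [IsProbabilityMeasure μ]
    (hμ : averageMeasure f μ = μ) {φ : X → E} {C : ℝ} (hφ : ∀ a, ‖φ a‖ ≤ C)
    (hφe : Continuous (φ ∘ e)) (a : X) :
    Tendsto (fun n => (average F)^[n] φ a) atTop (𝓝 (∫ x, φ (e x) ∂μ)) := by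
  have : Nonempty ι := nonempty_of_averageMeasure_eq hμ
  set c := ∫ x, φ (e x) ∂μ
  refine Metric.tendsto_atTop.2 fun r hr => ?_
  obtain ⟨N, hN⟩ := (eventually_norm_iterate_average_branches_sub_integral_le hκ hf hμ hφe
    (half_pos hr)).exists
  rw [← iterate_average_comp_of_semiconj h.apply_eq] at hN
  have hbound : ∀ b, ‖(average F)^[N] φ b - c‖ ≤ r / 2 + (C + ‖c‖) := fun b =>
    (HolCorr.norm_iterate_average_sub_le (S := Set.univ) (fun a _ => h.ne_zero a) (by simp)
      (fun a _ => (norm_sub_le _ _).trans (add_le_add_left (hφ a) _)) N b trivial).trans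
      (le_add_of_nonneg_left (half_pos hr).le)
  have hlim : Tendsto (fun m => r / 2 + (1 - (Fintype.card ι : ℝ)⁻¹) ^ m * (C + ‖c‖)) atTop
      (𝓝 (r / 2 + 0 * (C + ‖c‖))) :=
    ((tendsto_pow_atTop_nhds_zero_of_lt_one (sub_nonneg.2 (Nat.cast_inv_le_one _))
      (sub_lt_self 1 (by positivity))).mul_const _).const_add _
  obtain ⟨M, hM⟩ := eventually_atTop.1
    (hlim.eventually_lt_const (by simpa using half_lt_self hr : r / 2 + 0 * (C + ‖c‖) < r))
  refine ⟨M + N, fun n hn => ?_⟩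
  obtain ⟨m, rfl⟩ := Nat.exists_eq_add_of_le' ((Nat.le_add_left N M).trans hn)
  rw [dist_eq_norm, Function.iterate_add_apply]
  exact (h.norm_iterate_average_sub_le hN hbound m a).trans_lt
    (hM m (Nat.le_of_add_le_add_right hn))

end HasBranches

end Branches

section Sphere

variable {E : Type*} [NormedAddCommGroup E] [NormedSpace ℝ E] {F : Sphere → Multiset Sphere}

lemma card_iter {d : ℕ} (hF : ∀ a, (F a).card = d) (n : ℕ) (a : Sphere) :
    (iter F n a).card = d ^ n := by
  induction n with
  | zero => simp [iter]
  | succ n ih => simp [iter, Multiset.card_bind, hF, ih, pow_succ]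

lemma average_iter {d : ℕ} (hF : ∀ a, (F a).card = d) (n : ℕ) (φ : Sphere → E) :
    average (iter F n) φ = (average F)^[n] φ := by
  induction n generalizing φ with
  | zero => funext a; simp [average, iter]
  | succ n ih =>
    rw [Function.iterate_succ_apply, ← ih]
    funext a
    calc average (iter F (n + 1)) φ a
        = ((d : ℝ) ^ (n + 1))⁻¹ • ((iter F n a).map fun b => ((F b).map φ).sum).sum := by
          rw [average, card_iter hF, iter, Multiset.map_bind, Multiset.sum_bind, Nat.cast_pow]
      _ = ((d : ℝ) ^ n)⁻¹ • ((iter F n a).map fun b => (d : ℝ)⁻¹ • ((F b).map φ).sum).sum := by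
          rw [pow_succ, mul_inv, mul_smul, Multiset.smul_sum (r := (d : ℝ)⁻¹), Multiset.map_map]
          rfl
      _ = average (iter F n) (average F φ) a := by
          simp only [average.eq_def (iter F n), average.eq_def F, card_iter hF, hF, Nat.cast_pow]

lemma diracSum_cons (a : Sphere) (s : Multiset Sphere) :
    diracSum (a ::ₘ s) = Measure.dirac a + diracSum s := by
  simp [diracSum]

lemma diracSum_branches {ι : Type*} [Fintype ι] (b : ι → Sphere) :
    diracSum (Finset.univ.val.map b) = ∑ i, Measure.dirac (b i) := by
  rw [diracSum, Multiset.map_map, Finset.sum, Function.comp_def]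

instance isFiniteMeasure_diracSum (s : Multiset Sphere) : IsFiniteMeasure (diracSum s) := by
  induction s using Multiset.induction_on with
  | empty => simpa [diracSum] using (inferInstance : IsFiniteMeasure (0 : Measure Sphere))
  | cons a s ih => rw [diracSum_cons]; infer_instance

lemma integral_diracSum [CompleteSpace E] (s : Multiset Sphere) {φ : Sphere → E}
    (hφ : Continuous φ) : ∫ x, φ x ∂(diracSum s) = (s.map φ).sum := by
  induction s using Multiset.induction_on with
  | empty => simp [diracSum]
  | cons a s ih =>
    rw [diracSum_cons, integral_add_measure (integrable_of_continuous_of_compactSpace _ hφ)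
      (integrable_of_continuous_of_compactSpace _ hφ), ih, integral_dirac, Multiset.map_cons,
      Multiset.sum_cons]

lemma pushforward_dirac (F : Sphere → Multiset Sphere) (a : Sphere) :
    pushforward F (Measure.dirac a) = diracSum (F a) := by
  have h : (fun b => diracSum (F b)) =ᵐ[Measure.dirac a] fun _ => diracSum (F a) := by
    rw [EventuallyEq, ae_dirac_eq]; rfl
  rw [pushforward, Measure.bind_congr_right h, Measure.bind_const]
  simp

lemma integral_smul_pushforward_iter_dirac [CompleteSpace E] {d : ℕ} (hF : ∀ a, (F a).card = d)
    (n : ℕ) (a : Sphere) {φ : Sphere → E} (hφ : Continuous φ) :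
    ∫ x, φ x ∂(((d : ENNReal) ^ n)⁻¹ • pushforward (iter F n) (Measure.dirac a)) =
      (average F)^[n] φ a := by
  rw [pushforward_dirac, integral_smul_measure, integral_diracSum _ hφ, ← average_iter hF,
    average, card_iter hF]
  simp

variable {ι K : Type*} [Fintype ι] [MeasurableSpace K] {e : K → Sphere} {f : ι → K → K}

namespace HasBranches

lemma pushforward_map [Nonempty ι] (h : HasBranches F e f) (he : MeasurableEmbedding e)
    (hf : ∀ i, Measurable (f i)) (μ : Measure K) :
    pushforward F (μ.map e) = (Fintype.card ι : ENNReal) • (averageMeasure f μ).map e := by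
  have hdirac : ∀ x, diracSum (F (e x)) = ∑ i, Measure.dirac (e (f i x)) := fun x => by
    rw [h.apply_eq, branches, Multiset.map_map, Function.comp_def, diracSum_branches]
  have hmeas : AEMeasurable (fun a => diracSum (F a)) (μ.map e) := by
    rw [he.aemeasurable_map_iff]
    simp only [Function.comp_def, hdirac]
    refine (Measure.measurable_of_measurable_coe _ fun s hs => ?_).aemeasurable
    simp only [Measure.finsetSum_apply, Measure.dirac_apply' _ hs]
    exact Finset.measurable_sum _ fun i _ =>
      (measurable_one.indicator hs).comp (he.measurable.comp (hf i))
  ext s hs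
  have hs' : ∀ i, MeasurableSet ((fun x => e (f i x)) ⁻¹' s) := fun i =>
    (he.measurable.comp (hf i)) hs
  rw [pushforward, Measure.bind_apply hs hmeas, he.lintegral_map]
  simp only [hdirac, Measure.finsetSum_apply, Measure.dirac_apply' _ hs]
  rw [lintegral_finsetSum (f := fun i x => s.indicator 1 (e (f i x))) _
    fun i _ => measurable_one.indicator (hs' i), averageMeasure, Measure.map_smul, smul_smul,
    ENNReal.mul_inv_cancel (by simp) (by simp), one_smul, he.map_apply, Measure.finsetSum_apply]
  refine Finset.sum_congr rfl fun i _ => ?_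
  rw [Measure.map_apply (hf i) (he.measurable hs)]
  exact lintegral_indicator_one (hs' i)

variable [MetricSpace K] [CompactSpace K] [BorelSpace K] {κ : NNReal} {μ : Measure K}
  [IsProbabilityMeasure μ]

theorem weakStarTendsto (h : HasBranches F e f) (he : IsClosedEmbedding e) (hκ : κ < 1)
    (hf : ∀ i, LipschitzWith κ (f i)) (hμ : averageMeasure f μ = μ) (a : Sphere) :
    WeakStarTendsto (fun n => ((Fintype.card ι : ENNReal) ^ n)⁻¹ •
      pushforward (iter F n) (Measure.dirac a)) (μ.map e) := by
  intro φ
  simp_rw [integral_smul_pushforward_iter_dirac h.card_eq _ _ φ.continuous,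
    he.measurableEmbedding.integral_map]
  exact h.tendsto_iterate_average hκ hf hμ φ.norm_coe_le_norm (φ.continuous.comp he.continuous) a

end HasBranches

end Sphere

section Curve

variable {R : MvPolynomial (Fin 2) ℂ}

instance instMetrizableSpaceSphere : TopologicalSpace.MetrizableSpace Sphere :=
  (onePointEquivSphereOfFinrankEq (ι := Fin 3) (V := ℂ)
    (by simp [Complex.finrank_real_complex])).isEmbedding.metrizableSpace

lemma isClosed_curve (R : MvPolynomial (Fin 2) ℂ) : IsClosed (curve R) := isClosed_closure

lemma continuous_eval_pair (R : MvPolynomial (Fin 2) ℂ) :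
    Continuous fun p : ℂ × ℂ => MvPolynomial.eval ![p.1, p.2] R := by
  refine (MvPolynomial.continuous_eval R).comp (continuous_pi fun i => ?_)
  fin_cases i
  · exact continuous_fst
  · exact continuous_snd

lemma coe_mem_image_coe_iff {z w : ℂ} :
    (w : Sphere) ∈ image R (z : Sphere) ↔ MvPolynomial.eval ![z, w] R = 0 := by
  have hcurve : curve R = closure (Prod.map (↑) (↑) '' {p : ℂ × ℂ |
      MvPolynomial.eval ![p.1, p.2] R = 0}) := by
    rw [curve]
    congr 1
    ext p
    simp [eq_comm]
  have hind : IsInducing (Prod.map (↑) (↑) : ℂ × ℂ → Sphere × Sphere) :=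
    OnePoint.isOpenEmbedding_coe.isInducing.prodMap OnePoint.isOpenEmbedding_coe.isInducing
  have hclosed : IsClosed {p : ℂ × ℂ | MvPolynomial.eval ![p.1, p.2] R = 0} :=
    isClosed_eq (continuous_eval_pair R) continuous_const
  have hpre := hind.closure_eq_preimage_closure_image
    {p : ℂ × ℂ | MvPolynomial.eval ![p.1, p.2] R = 0}
  rw [hclosed.closure_eq, ← hcurve] at hpre
  exact (Set.ext_iff.1 hpre (z, w)).symm

lemma infty_notMem_image_coe {z : ℂ} {ρ : ℝ}
    (h : ∀ᶠ x in 𝓝 z, ∀ w, MvPolynomial.eval ![x, w] R = 0 → ‖w‖ ≤ ρ) :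
    OnePoint.infty ∉ image R (z : Sphere) := by
  have hz : ∀ᶠ a : Sphere in 𝓝 (z : Sphere), ∀ x : ℂ, a = x →
      ∀ w, MvPolynomial.eval ![x, w] R = 0 → ‖w‖ ≤ ρ := by
    rw [OnePoint.nhds_coe_eq, eventually_map]
    filter_upwards [h] with x hx y hxy
    rwa [← OnePoint.coe_injective hxy]
  have hinfty : ∀ᶠ b : Sphere in 𝓝 OnePoint.infty, ∀ w : ℂ, b = w → ρ < ‖w‖ := by
    filter_upwards [((isCompact_closedBall (0 : ℂ) ρ).image
      OnePoint.continuous_coe).isClosed.isOpen_compl.mem_nhds (by simp)] with b hb w hbw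
    by_contra! hw
    exact hb ⟨w, by simpa using hw, hbw.symm⟩
  intro hmem
  obtain ⟨p, ⟨⟨x, w, hxw, rfl⟩, hx⟩, hw⟩ := ((mem_closure_iff_frequently.1 hmem).and_eventually
    (hz.prod_inl_nhds _)).and_eventually (hinfty.prod_inr_nhds _) |>.exists
  exact (hw w rfl).not_ge (hx x rfl w hxw)

lemma image_inter_nonempty_of_isCompact {K : Set Sphere} (hK : IsCompact K)
    (h : ∀ z : ℂ, (image R (z : Sphere) ∩ K).Nonempty) (a : Sphere) :
    (image R a ∩ K).Nonempty := by
  have hclosed : IsClosed (Prod.fst '' (curve R ∩ Set.univ ×ˢ K)) :=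
    (((isClosed_curve R).inter (isClosed_univ.prod hK.isClosed)).isCompact.image
      continuous_fst).isClosed
  have hsub : Set.range (fun z : ℂ => (z : Sphere)) ⊆ Prod.fst '' (curve R ∩ Set.univ ×ˢ K) := by
    rintro _ ⟨z, rfl⟩
    obtain ⟨b, hb, hbK⟩ := h z
    exact ⟨(z, b), ⟨hb, trivial, hbK⟩, rfl⟩
  obtain ⟨⟨_, b⟩, ⟨hb, -, hbK⟩, rfl⟩ :=
    hclosed.closure_subset_iff.2 hsub (OnePoint.denseRange_coe a)
  exact ⟨b, hb, hbK⟩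

end Curve

section EquilibriumMeasure

/-- The inclusion of a closed disc centred at `0` in the Riemann sphere. -/
def discIncl (ρ : ℝ) (x : Metric.closedBall (0 : ℂ) ρ) : Sphere := ((x : ℂ) : Sphere)

lemma isClosedEmbedding_discIncl (ρ : ℝ) : IsClosedEmbedding (discIncl ρ) :=
  (OnePoint.continuous_coe.comp continuous_subtype_val).isClosedEmbedding
    (OnePoint.coe_injective.comp Subtype.val_injective)

variable {R : MvPolynomial (Fin 2) ℂ}

lemma eval_fibre_coe (R : MvPolynomial (Fin 2) ℂ) (z w : ℂ) :
    (fibre R (z : Sphere)).eval w = MvPolynomial.eval ![z, w] R := by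
  have hhom : (Polynomial.aeval w).comp (MvPolynomial.aeval ![Polynomial.C z, Polynomial.X]) =
      (MvPolynomial.aeval ![z, w] : MvPolynomial (Fin 2) ℂ →ₐ[ℂ] ℂ) := by
    ext i
    fin_cases i <;> simp
  exact DFunLike.congr_fun hhom R

lemma coe_mem_images_iff {a : Sphere} {w : ℂ} :
    (w : Sphere) ∈ images R a ↔ w ∈ (fibre R a).roots := by
  simp [images, Multiset.mem_replicate]

lemma coe_mem_image_coe_of_mem_images {z w : ℂ} (h : (w : Sphere) ∈ images R (z : Sphere)) :
    (w : Sphere) ∈ image R (z : Sphere) := by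
  rw [coe_mem_image_coe_iff, ← eval_fibre_coe]
  exact (Polynomial.mem_roots'.1 (coe_mem_images_iff.1 h)).2

variable {ι : Type*} [Fintype ι] {ρ : ℝ}
  {f : ι → Metric.closedBall (0 : ℂ) ρ → Metric.closedBall (0 : ℂ) ρ}

namespace HasBranches

lemma exists_apply_eq_of_eval_eq_zero (h : HasBranches (images R) (discIncl ρ) f)
    (x : Metric.closedBall (0 : ℂ) ρ) {w : ℂ} (hw : MvPolynomial.eval ![(x : ℂ), w] R = 0) :
    ∃ i, (f i x : ℂ) = w := by
  obtain ⟨y, hy⟩ := h.exists_mem (discIncl ρ x)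
  have hne : fibre R (discIncl ρ x) ≠ 0 := (Polynomial.mem_roots'.1 (coe_mem_images_iff.1 hy)).1
  have hmem : (w : Sphere) ∈ images R (discIncl ρ x) :=
    coe_mem_images_iff.2 (Polynomial.mem_roots'.2 ⟨hne, (eval_fibre_coe R x w).trans hw⟩)
  obtain ⟨i, hi⟩ := h.mem_iff.1 hmem
  exact ⟨i, OnePoint.coe_injective hi⟩

lemma exists_apply_eq_of_mem_image (h : HasBranches (images R) (discIncl ρ) f)
    {x : Metric.closedBall (0 : ℂ) ρ} (hx : ‖(x : ℂ)‖ < ρ) {b : Sphere}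
    (hb : b ∈ image R (discIncl ρ x)) : ∃ i, discIncl ρ (f i x) = b := by
  have hbdd : ∀ᶠ z in 𝓝 (x : ℂ), ∀ w, MvPolynomial.eval ![z, w] R = 0 → ‖w‖ ≤ ρ := by
    filter_upwards [Metric.isOpen_ball.mem_nhds (mem_ball_zero_iff.2 hx)] with z hz w hw
    obtain ⟨i, rfl⟩ := h.exists_apply_eq_of_eval_eq_zero ⟨z, Metric.ball_subset_closedBall hz⟩ hw
    exact mem_closedBall_zero_iff.1 (f i _).2
  induction b using OnePoint.rec with
  | infty => exact absurd hb (infty_notMem_image_coe hbdd)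
  | coe w =>
    obtain ⟨i, rfl⟩ := h.exists_apply_eq_of_eval_eq_zero x (coe_mem_image_coe_iff.1 hb)
    exact ⟨i, rfl⟩

lemma image_inter_range_nonempty (h : HasBranches (images R) (discIncl ρ) f) (a : Sphere) :
    (image R a ∩ Set.range (discIncl ρ)).Nonempty := by
  refine image_inter_nonempty_of_isCompact
    (isCompact_range (isClosedEmbedding_discIncl ρ).continuous) (fun z => ?_) a
  obtain ⟨x, hx⟩ := h.exists_mem z
  exact ⟨discIncl ρ x, coe_mem_image_coe_of_mem_images hx, x, rfl⟩

variable {κ : NNReal} {μ : Measure (Metric.closedBall (0 : ℂ) ρ)}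

lemma forwardInvariant_support (h : HasBranches (images R) (discIncl ρ) f)
    (hf : ∀ i, Continuous (f i)) (hlt : ∀ i x, ‖(f i x : ℂ)‖ < ρ) (hμ : averageMeasure f μ = μ) :
    ForwardInvariant R (discIncl ρ '' μ.support) := by
  rintro _ ⟨x, hx, rfl⟩ b hb
  have hxρ : ‖(x : ℂ)‖ < ρ := by
    obtain ⟨i, y, rfl⟩ :=
      Set.mem_iUnion.1 (support_subset_iUnion_range_of_averageMeasure_eq hf hμ hx)
    exact hlt i y
  obtain ⟨i, rfl⟩ := h.exists_apply_eq_of_mem_image hxρ hb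
  exact ⟨f i x, apply_mem_support_of_averageMeasure_eq hf hμ hx i, rfl⟩

lemma image_support_subset [IsProbabilityMeasure μ] (h : HasBranches (images R) (discIncl ρ) f)
    (hκ : κ < 1) (hf : ∀ i, LipschitzWith κ (f i)) (hμ : averageMeasure f μ = μ) {S : Set Sphere}
    (hne : S.Nonempty) (hclosed : IsClosed S) (hS : ForwardInvariant R S) :
    discIncl ρ '' μ.support ⊆ S := by
  have hcont := (isClosedEmbedding_discIncl ρ).continuous
  obtain ⟨a, ha⟩ := hne
  obtain ⟨_, hb, x, rfl⟩ := h.image_inter_range_nonempty a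
  refine Set.image_subset_iff.2 (support_subset_of_forall_apply_mem hκ hf hμ
    (hclosed.preimage hcont) ⟨x, hS a ha hb⟩ fun y hy i => hS _ hy ?_)
  exact coe_mem_image_coe_of_mem_images (h.mem_iff.2 ⟨i, rfl⟩)

end HasBranches

theorem exists_equilibriumMeasure (h : HasBranches (images R) (discIncl ρ) f) {κ : NNReal}
    (hκ : κ < 1) (hf : ∀ i, LipschitzWith κ (f i)) (hlt : ∀ i x, ‖(f i x : ℂ)‖ < ρ) :
    ∃ μ : Measure Sphere, IsProbabilityMeasure μ ∧
      pushforward (images R) μ = (Fintype.card ι : ENNReal) • μ ∧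
      (∀ a : Sphere, WeakStarTendsto (fun n => ((Fintype.card ι : ENNReal) ^ n)⁻¹ •
        pushforward (iter (images R) n) (Measure.dirac a)) μ) ∧
      μ.support ⊆ ⋃ i, Set.range (discIncl ρ ∘ f i) ∧
      IsLeast {S : Set Sphere | S.Nonempty ∧ IsClosed S ∧ ForwardInvariant R S} μ.support := by
  have he := isClosedEmbedding_discIncl ρ
  have hc : ∀ i, Continuous (f i) := fun i => (hf i).continuous
  have : Nonempty ι := h.nonempty
  have : Nonempty (Metric.closedBall (0 : ℂ) ρ) := (h.exists_mem OnePoint.infty).nonempty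
  obtain ⟨ν, hν, hinv⟩ := exists_averageMeasure_eq hκ hf
  have hprob : IsProbabilityMeasure (ν.map (discIncl ρ)) :=
    Measure.isProbabilityMeasure_map he.continuous.measurable.aemeasurable
  have hsupp := support_map_of_isClosedEmbedding he ν
  refine ⟨ν.map (discIncl ρ), hprob, ?_, h.weakStarTendsto he hκ hf hinv, ?_, ⟨?_, ?_, ?_⟩, ?_⟩
  · rw [h.pushforward_map he.measurableEmbedding (fun i => (hc i).measurable), hinv]
  · simp only [hsupp, Set.range_comp, ← Set.image_iUnion]
    gcongr
    exact support_subset_iUnion_range_of_averageMeasure_eq hc hinv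
  · exact Measure.nonempty_support (IsProbabilityMeasure.ne_zero _)
  · exact Measure.isClosed_support
  · exact hsupp ▸ h.forwardInvariant_support hc hlt hinv
  · rintro S ⟨hne, hclosed, hS⟩
    exact hsupp ▸ h.image_support_subset hκ hf hinv hne hclosed hS

end EquilibriumMeasure

section Roots

open Polynomial

variable {𝕜 : Type*} [NormedField 𝕜] [IsAlgClosed 𝕜]

-- The roots of the reversed polynomial are the inverses of the roots.
lemma norm_coeff_mul_pow_le_of_forall_le_norm_root {p : 𝕜[X]} {ρ : ℝ} (hρ : 0 < ρ)
    (h : ∀ w, p.IsRoot w → ρ ≤ ‖w‖) (k : ℕ) :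
    ‖p.coeff k‖ * ρ ^ k ≤ p.natDegree.choose k * ‖p.coeff 0‖ := by
  have h0 : p.coeff 0 ≠ 0 := fun h0 =>
    hρ.not_ge (by simpa using h 0 (zero_isRoot_of_coeff_zero_eq_zero h0))
  have htrail : p.natTrailingDegree = 0 := natTrailingDegree_eq_zero.2 (Or.inr h0)
  have hdeg : p.reverse.natDegree = p.natDegree := by rw [reverse_natDegree, htrail, Nat.sub_zero]
  rcases lt_or_ge p.natDegree k with hk | hk
  · simp [coeff_eq_zero_of_natDegree_lt hk, Nat.choose_eq_zero_of_lt hk]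
  have hroots : ∀ v ∈ (C (p.coeff 0)⁻¹ * p.reverse).roots, ‖v‖ ≤ ρ⁻¹ := by
    rw [roots_C_mul _ (inv_ne_zero h0)]
    intro v hv
    rcases eq_or_ne v 0 with rfl | hv0
    · simpa using hρ.le
    have hinv := invertibleOfNonzero (inv_ne_zero hv0)
    have hroot := h v⁻¹ ((eval₂_reverse_eq_zero_iff (RingHom.id 𝕜) v⁻¹ p).1 (by
      simpa [eval₂_id] using (mem_roots'.1 hv).2))
    rw [norm_inv] at hroot
    exact (le_inv_comm₀ hρ (norm_pos_iff.2 hv0)).1 hroot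
  have hmonic : (C (p.coeff 0)⁻¹ * p.reverse).Monic := by
    rw [Monic, leadingCoeff_mul, leadingCoeff_C, reverse_leadingCoeff, trailingCoeff, htrail,
      inv_mul_cancel₀ h0]
  have hbound := coeff_le_of_roots_le (f := RingHom.id 𝕜) (p.natDegree - k) hmonic
    (IsAlgClosed.splits _) (by simpa only [Polynomial.map_id] using hroots)
  rw [Polynomial.map_id, natDegree_C_mul (inv_ne_zero h0), hdeg, coeff_C_mul, coeff_reverse,
    revAt_le (Nat.sub_le _ _), Nat.sub_sub_self hk, Nat.choose_symm hk, norm_mul, norm_inv,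
    inv_mul_le_iff₀ (norm_pos_iff.2 h0), inv_pow] at hbound
  calc ‖p.coeff k‖ * ρ ^ k
      ≤ ‖p.coeff 0‖ * ((ρ ^ k)⁻¹ * p.natDegree.choose k) * ρ ^ k := by gcongr
    _ = p.natDegree.choose k * ‖p.coeff 0‖ := by field_simp

lemma exists_mem_roots_norm_lt_of_mul_norm_coeff_zero_lt {p : 𝕜[X]} {ρ : ℝ} (hρ : 1 ≤ ρ) {k : ℕ}
    (hk : k ≠ 0) (h : 2 ^ p.natDegree * ‖p.coeff 0‖ < ‖p.coeff k‖ * ρ) :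
    ∃ w ∈ p.roots, ‖w‖ < ρ := by
  have hp : p ≠ 0 := by rintro rfl; simp at h
  by_contra! hroots
  refine h.not_ge ?_
  calc ‖p.coeff k‖ * ρ ≤ ‖p.coeff k‖ * ρ ^ k := by gcongr; exact le_self_pow₀ hρ hk
    _ ≤ p.natDegree.choose k * ‖p.coeff 0‖ :=
      norm_coeff_mul_pow_le_of_forall_le_norm_root (by positivity)
        (fun w hw => hroots w ((mem_roots hp).2 hw)) k
    _ ≤ 2 ^ p.natDegree * ‖p.coeff 0‖ := by
      gcongr
      exact_mod_cast Nat.choose_le_two_pow _ _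

end Roots

section Pencil

open Polynomial

variable {𝕜 : Type*} [NontriviallyNormedField 𝕜] [CompleteSpace 𝕜]
  {E : Type*} [NormedAddCommGroup E] [NormedSpace 𝕜 E] [FiniteDimensional 𝕜 E]

lemma exists_forall_exists_mul_norm_le_norm_coeff (L : E →ₗ[𝕜] 𝕜[X]) {d : ℕ}
    (hd : ∀ v, (L v).natDegree ≤ d) (hL : ∀ v ≠ 0, (L v).natDegree ≠ 0) :
    ∃ c > 0, ∀ v ≠ 0, ∃ k ≤ d, k ≠ 0 ∧ c * ‖v‖ ≤ ‖(L v).coeff k‖ := by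
  let T : E →ₗ[𝕜] Fin d → 𝕜 := LinearMap.pi fun k => lcoeff 𝕜 (k + 1) ∘ₗ L
  have hT : LinearMap.ker T = ⊥ := by
    refine LinearMap.ker_eq_bot'.2 fun v hv => by_contra fun hv0 => hL v hv0 ?_
    refine Nat.le_zero.1 (natDegree_le_iff_coeff_eq_zero.2 fun k hk => ?_)
    obtain ⟨k, rfl⟩ := Nat.exists_eq_add_one_of_ne_zero hk.ne'
    rcases lt_or_ge k d with hkd | hkd
    · exact congr_fun hv ⟨k, hkd⟩
    · exact coeff_eq_zero_of_natDegree_lt ((hd v).trans_lt (by omega))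
  obtain ⟨K, hK, hTK⟩ := T.exists_antilipschitzWith hT
  have hK' : (0 : ℝ) < K := hK
  refine ⟨(K : ℝ)⁻¹, inv_pos.2 hK', fun v hv => ?_⟩
  have hbelow : (K : ℝ)⁻¹ * ‖v‖ ≤ ‖T v‖ := by
    rw [inv_mul_le_iff₀ hK']
    simpa using hTK.le_mul_dist v 0
  by_contra! hcoeff
  refine hbelow.not_gt ((pi_norm_lt_iff (by positivity)).2 fun k => ?_)
  exact hcoeff (k + 1) k.2 (Nat.succ_ne_zero _)

lemma exists_eventually_exists_mem_roots_norm_lt [IsAlgClosed 𝕜] (L : E →ₗ[𝕜] 𝕜[X]) {d : ℕ}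
    (hd : ∀ v, (L v).natDegree ≤ d) (hL : ∀ v ≠ 0, (L v).natDegree ≠ 0) :
    ∃ η > 0, ∀ᶠ ρ : ℝ in atTop, ∀ v ≠ 0, ∀ p : 𝕜[X], p.natDegree ≤ d →
      (∀ k ≤ d, ‖p.coeff k - (L v).coeff k‖ ≤ η * ‖v‖) → ∃ w ∈ p.roots, ‖w‖ < ρ := by
  obtain ⟨c, hc, hcoeff⟩ := exists_forall_exists_mul_norm_le_norm_coeff L hd hL
  let ℓ : E →L[𝕜] 𝕜 := LinearMap.toContinuousLinearMap (lcoeff 𝕜 0 ∘ₗ L)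
  refine ⟨c / 2, half_pos hc, ?_⟩
  filter_upwards [eventually_ge_atTop 1,
    eventually_gt_atTop (2 ^ d * (‖ℓ‖ + c / 2) / (c / 2))] with ρ h1 hρ v hv p hp hpv
  rw [div_lt_iff₀' (half_pos hc)] at hρ
  obtain ⟨k, hkd, hk, hck⟩ := hcoeff v hv
  have hp0 : ‖p.coeff 0‖ ≤ (‖ℓ‖ + c / 2) * ‖v‖ := by
    have hle := norm_le_norm_add_norm_sub' (p.coeff 0) ((L v).coeff 0)
    linarith [hpv 0 d.zero_le, show ‖(L v).coeff 0‖ ≤ ‖ℓ‖ * ‖v‖ from ℓ.le_opNorm v]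
  have hpk : c / 2 * ‖v‖ ≤ ‖p.coeff k‖ := by
    have hle := norm_le_norm_add_norm_sub (p.coeff k) ((L v).coeff k)
    linarith [hpv k hkd]
  refine exists_mem_roots_norm_lt_of_mul_norm_coeff_zero_lt h1 hk ?_
  calc 2 ^ p.natDegree * ‖p.coeff 0‖ ≤ 2 ^ d * ((‖ℓ‖ + c / 2) * ‖v‖) := by
        gcongr
        exact one_le_two
    _ = 2 ^ d * (‖ℓ‖ + c / 2) * ‖v‖ := by ring
    _ < c / 2 * ρ * ‖v‖ := mul_lt_mul_of_pos_right hρ (norm_pos_iff.2 hv)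
    _ = c / 2 * ‖v‖ * ρ := by ring
    _ ≤ ‖p.coeff k‖ * ρ := by gcongr

end Pencil

section Branches

open Polynomial

variable {𝕜 : Type*} [NormedField 𝕜] [IsAlgClosed 𝕜] {ι : Type*} [Fintype ι]

lemma exists_mem_roots_dist_lt {p : 𝕜[X]} {u : 𝕜} {r : ℝ} (hr : 0 < r)
    (h : ‖p.eval u‖ < ‖p.leadingCoeff‖ * r ^ p.natDegree) : ∃ w ∈ p.roots, dist w u < r := by
  by_contra! hroots
  refine h.not_ge ?_
  have hs := IsAlgClosed.splits p
  rw [hs.eval_eq_prod_roots u, norm_mul, hs.natDegree_eq_card_roots, ← Multiset.prod_replicate,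
    ← Multiset.map_const']
  change _ ≤ _ * normHom (p.roots.map (u - ·)).prod
  rw [map_multiset_prod, Multiset.map_map]
  gcongr
  refine Multiset.prod_map_le_prod_map₀ _ _ (fun _ _ => hr.le) fun w hw => ?_
  exact (hroots w hw).trans_eq (dist_comm w u ▸ dist_eq_norm u w)

lemma mul_dist_le_norm_eval {p : 𝕜[X]} {g : ι → 𝕜} (hg : p.roots = Finset.univ.val.map g) {s : ℝ}
    (hs : 0 ≤ s) {w : 𝕜} (i : ι) (h : ∀ k ≠ i, s ≤ dist w (g k)) :
    ‖p.leadingCoeff‖ * s ^ (Fintype.card ι - 1) * dist w (g i) ≤ ‖p.eval w‖ := by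
  classical
  have heval : p.eval w = p.leadingCoeff * ((w - g i) * ∏ k ∈ Finset.univ.erase i, (w - g k)) := by
    rw [Finset.mul_prod_erase _ (fun k => w - g k) (Finset.mem_univ i),
      (IsAlgClosed.splits p).eval_eq_prod_roots w, hg, Multiset.map_map]
    rfl
  rw [heval, norm_mul, norm_mul, norm_prod, mul_assoc, mul_comm (s ^ _), dist_eq_norm,
    ← Finset.card_univ, ← Finset.card_erase_of_mem (Finset.mem_univ i)]
  gcongr
  rw [← Finset.prod_const]
  refine Finset.prod_le_prod (fun _ _ => hs) fun k hk => ?_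
  exact dist_eq_norm w (g k) ▸ h k (Finset.ne_of_mem_erase hk)

lemma exists_roots_eq_map_of_norm_eval_lt {p : 𝕜[X]} (hp : p.natDegree = Fintype.card ι)
    {c : ι → 𝕜} {r : ℝ} (hr : 0 < r) (hsep : Pairwise fun i k => 2 * r ≤ dist (c i) (c k))
    (h : ∀ i, ‖p.eval (c i)‖ < ‖p.leadingCoeff‖ * r ^ Fintype.card ι) :
    ∃ g : ι → 𝕜, (∀ i, dist (g i) (c i) < r) ∧ p.roots = Finset.univ.val.map g := by
  choose g hroot hdist using fun i => exists_mem_roots_dist_lt hr (hp ▸ h i)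
  have hinj : Function.Injective g := by
    intro i k hik
    by_contra hne
    have htri := dist_triangle_left (c i) (c k) (g i)
    linarith [hsep hne, hdist i, hik ▸ hdist k]
  refine ⟨g, hdist, (Multiset.eq_of_le_of_card_le ?_ ?_).symm⟩
  · rw [Multiset.le_iff_subset (Finset.univ.nodup.map hinj)]
    simpa [Multiset.subset_iff] using fun i => mem_roots'.1 (hroot i)
  · rw [Multiset.card_map, Finset.card_val, Finset.card_univ, ← hp]
    exact card_roots' p

lemma exists_lipschitzWith_roots_eq_map {X : Type*} [PseudoMetricSpace X] {p : X → 𝕜[X]}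
    (hp : ∀ x, (p x).natDegree = Fintype.card ι) {ℓ : ℝ} (hℓ : 0 < ℓ)
    (hlc : ∀ x, ℓ ≤ ‖(p x).leadingCoeff‖) {c : ι → 𝕜} {r : ℝ} (hr : 0 < r)
    (hsep : Pairwise fun i k => 4 * r ≤ dist (c i) (c k))
    (heval : ∀ x i, ‖(p x).eval (c i)‖ < ℓ * r ^ Fintype.card ι) {κ : NNReal}
    (hlip : ∀ x y i, ∀ w ∈ Metric.ball (c i) r,
      ‖(p x).eval w - (p y).eval w‖ ≤ ℓ * (2 * r) ^ (Fintype.card ι - 1) * (κ * dist x y)) :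
    ∃ g : ι → X → 𝕜, (∀ i, LipschitzWith κ (g i)) ∧ (∀ i x, dist (g i x) (c i) < r) ∧
      ∀ x, (p x).roots = Finset.univ.val.map fun i => g i x := by
  have hroots : ∀ x, ∃ g : ι → 𝕜, (∀ i, dist (g i) (c i) < r) ∧
      (p x).roots = Finset.univ.val.map g := fun x =>
    exists_roots_eq_map_of_norm_eval_lt (hp x) hr
      (hsep.mono fun i k h => (by linarith : 2 * r ≤ 4 * r).trans h)
      fun i => (heval x i).trans_le (by gcongr; exact hlc x)
  choose g hdist hroots using hroots
  have hfar : ∀ x y i k, k ≠ i → 2 * r ≤ dist (g x i) (g y k) := by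
    intro x y i k hki
    have htri := dist_triangle4 (c i) (g x i) (g y k) (c k)
    linarith [hsep hki.symm, dist_comm (c i) (g x i) ▸ hdist x i, hdist y k]
  refine ⟨fun i x => g x i, fun i => LipschitzWith.of_dist_le_mul fun x y => ?_,
    fun i x => hdist x i, hroots⟩
  have hzero : (p x).eval (g x i) = 0 :=
    (mem_roots'.1 (hroots x ▸ Multiset.mem_map_of_mem (g x) (Finset.mem_univ_val i))).2
  refine le_of_mul_le_mul_left ?_ (by positivity : 0 < ℓ * (2 * r) ^ (Fintype.card ι - 1))
  calc ℓ * (2 * r) ^ (Fintype.card ι - 1) * dist (g x i) (g y i)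
      ≤ ‖(p y).leadingCoeff‖ * (2 * r) ^ (Fintype.card ι - 1) * dist (g x i) (g y i) := by
        gcongr
        exact hlc y
    _ ≤ ‖(p y).eval (g x i)‖ := mul_dist_le_norm_eval (hroots y) (by positivity) i (hfar x y i)
    _ = ‖(p x).eval (g x i) - (p y).eval (g x i)‖ := by rw [hzero, zero_sub, norm_neg]
    _ ≤ _ := hlip x y i _ (hdist x i)

lemma eventually_pairwise_mul_le_dist {α X : Type*} [Finite α] [MetricSpace X] {c : α → X}
    (hc : Function.Injective c) (C : ℝ) :
    ∀ᶠ r : ℝ in 𝓝[>] 0, Pairwise fun i k => C * r ≤ dist (c i) (c k) := by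
  have htendsto : Tendsto (fun r : ℝ => C * r) (𝓝[>] 0) (𝓝 0) := by
    simpa using (continuous_const_mul C).continuousWithinAt.tendsto (x := (0 : ℝ)) (s := Set.Ioi 0)
  simp only [Pairwise, eventually_all]
  intro i k hik
  exact htendsto.eventually_le_const (dist_pos.2 (hc.ne hik))

end Branches

section Fibres

open Polynomial

/-- `R(z, w)` as a polynomial in `z` with coefficients in `ℂ[w]`. -/
def collectZ (R : MvPolynomial (Fin 2) ℂ) : ℂ[X][X] := MvPolynomial.aeval ![X, C X] R

variable {R : MvPolynomial (Fin 2) ℂ}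

lemma collectZ_aeval_X_one (q : ℂ[X]) : collectZ (aeval (MvPolynomial.X 1) q) = C q := by
  have hhom : (MvPolynomial.aeval ![X, C X] : MvPolynomial (Fin 2) ℂ →ₐ[ℂ] ℂ[X][X]).comp
      (aeval (MvPolynomial.X 1)) = CAlgHom := by
    ext
    simp
  exact DFunLike.congr_fun hhom q

lemma eval_collectZ (R : MvPolynomial (Fin 2) ℂ) (z : ℂ) :
    (collectZ R).eval (C z) = fibre R (z : Sphere) := by
  have hhom : ((aeval (C z)).restrictScalars ℂ).comp
      (MvPolynomial.aeval ![X, C X] : MvPolynomial (Fin 2) ℂ →ₐ[ℂ] ℂ[X][X]) =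
      MvPolynomial.aeval ![C z, X] := by
    ext i
    fin_cases i <;> simp
  exact DFunLike.congr_fun hhom R

lemma natDegree_coeff_collectZ_le (R : MvPolynomial (Fin 2) ℂ) (l : ℕ) :
    ((collectZ R).coeff l).natDegree ≤ MvPolynomial.degreeOf 1 R := by
  rw [collectZ, MvPolynomial.aeval_def, MvPolynomial.eval₂_eq', finsetSum_coeff]
  refine natDegree_sum_le_of_forall_le _ _ fun m hm => ?_
  have hterm : (algebraMap ℂ ℂ[X][X] (R.coeff m) *
      ∏ i, (![X, C X] : Fin 2 → ℂ[X][X]) i ^ m i).coeff l =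
      if l = m 0 then C (R.coeff m) * X ^ m 1 else 0 := by
    have hmon : algebraMap ℂ ℂ[X][X] (R.coeff m) * ∏ i, (![X, C X] : Fin 2 → ℂ[X][X]) i ^ m i =
        C (C (R.coeff m) * X ^ m 1) * X ^ m 0 := by
      simp only [Fin.prod_univ_two, Matrix.cons_val_zero, Matrix.cons_val_one,
        IsScalarTower.algebraMap_apply ℂ ℂ[X] ℂ[X][X], algebraMap_eq, C_mul, C_pow]
      ring
    rw [hmon, coeff_C_mul_X_pow]
  rw [hterm]
  split_ifs
  · exact (natDegree_C_mul_X_pow_le _ _).trans (MvPolynomial.monomial_le_degreeOf 1 hm)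
  · simp

lemma natDegree_fibre_le (R : MvPolynomial (Fin 2) ℂ) (a : Sphere) :
    (fibre R a).natDegree ≤ MvPolynomial.degreeOf 1 R := by
  induction a using OnePoint.rec with
  | infty => exact natDegree_coeff_collectZ_le R _
  | coe z =>
    rw [← eval_collectZ, eval_eq_sum_range]
    refine natDegree_sum_le_of_forall_le _ _ fun l _ => ?_
    rw [← C_pow]
    exact (natDegree_mul_C_le _ _).trans (natDegree_coeff_collectZ_le R l)

lemma card_images (R : MvPolynomial (Fin 2) ℂ) (a : Sphere) :
    (images R a).card = MvPolynomial.degreeOf 1 R := by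
  rw [images, Multiset.card_add, Multiset.card_map, Multiset.card_replicate,
    ← (IsAlgClosed.splits _).natDegree_eq_card_roots, Nat.add_sub_cancel' (natDegree_fibre_le R a)]

lemma coeff_fibre_coe (R : MvPolynomial (Fin 2) ℂ) (z : ℂ) (m : ℕ) :
    (fibre R (z : Sphere)).coeff m =
      ∑ l ∈ Finset.range ((collectZ R).natDegree + 1), ((collectZ R).coeff l).coeff m * z ^ l := by
  simp only [← eval_collectZ, eval_eq_sum_range, finsetSum_coeff, ← C_pow, coeff_mul_C]

lemma continuous_coeff_fibre (R : MvPolynomial (Fin 2) ℂ) (m : ℕ) :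
    Continuous fun z : ℂ => (fibre R (z : Sphere)).coeff m := by
  simp only [coeff_fibre_coe]
  fun_prop

lemma eventually_cobounded_norm_coeff_fibre_sub_le (R : MvPolynomial (Fin 2) ℂ) (d : ℕ) {η : ℝ}
    (hη : 0 < η) : ∀ᶠ z : ℂ in Bornology.cobounded ℂ, ∀ m ≤ d,
      ‖(fibre R (z : Sphere)).coeff m -
        z ^ (collectZ R).natDegree * (fibre R OnePoint.infty).coeff m‖ ≤
      η * ‖z ^ (collectZ R).natDegree‖ := by
  refine (Set.finite_Iic d).eventually_all.2 fun m _ => ?_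
  have hlittle : (fun z : ℂ => ∑ l ∈ Finset.range (collectZ R).natDegree,
      ((collectZ R).coeff l).coeff m * z ^ l) =o[Bornology.cobounded ℂ]
      fun z => z ^ (collectZ R).natDegree :=
    Asymptotics.IsLittleO.fun_sum fun l hl => (Asymptotics.isLittleO_pow_pow_cobounded_of_lt
      (Finset.mem_range.1 hl)).const_mul_left _
  filter_upwards [hlittle.bound hη] with z hz
  rw [coeff_fibre_coe, Finset.sum_range_succ]
  convert hz using 2
  exact sub_eq_iff_eq_add.2 (congrArg _ (mul_comm _ _))

end Fibres

section Perturb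

open Polynomial

variable {R₀ : ℂ[X]} {P : MvPolynomial (Fin 2) ℂ}

lemma collectZ_perturb (R₀ : ℂ[X]) (P : MvPolynomial (Fin 2) ℂ) (δ : ℂ) :
    collectZ (perturb R₀ P δ) = C R₀ + δ • collectZ P := by
  rw [← collectZ_aeval_X_one, collectZ, perturb, ← MvPolynomial.smul_eq_C_mul, map_add, map_smul]
  rfl

lemma fibre_perturb_coe (R₀ : ℂ[X]) (P : MvPolynomial (Fin 2) ℂ) (δ z : ℂ) :
    fibre (perturb R₀ P δ) (z : Sphere) = R₀ + δ • fibre P (z : Sphere) := by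
  simp only [← eval_collectZ, collectZ_perturb, eval_add, eval_C, eval_smul]

lemma exists_fibre_perturb_infty_eq (R₀ : ℂ[X]) (P : MvPolynomial (Fin 2) ℂ) (δ : ℂ) :
    ∃ v : ℂ × ℂ, v ≠ 0 ∧
      fibre (perturb R₀ P δ) OnePoint.infty = v.1 • R₀ + v.2 • fibre P OnePoint.infty := by
  change ∃ v : ℂ × ℂ, v ≠ 0 ∧
    (collectZ (perturb R₀ P δ)).leadingCoeff = v.1 • R₀ + v.2 • (collectZ P).leadingCoeff
  rw [collectZ_perturb]
  rcases eq_or_ne δ 0 with rfl | hδ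
  · exact ⟨(1, 0), by simp, by simp⟩
  rcases eq_or_ne (collectZ P).natDegree 0 with hdeg | hdeg
  · refine ⟨(1, δ), by simp, ?_⟩
    rw [eq_C_of_natDegree_eq_zero hdeg, smul_C, ← C_add, leadingCoeff_C, leadingCoeff_C, one_smul]
  · refine ⟨(0, δ), by simpa using hδ, ?_⟩
    rw [leadingCoeff_add_of_degree_lt, zero_smul, zero_add]
    · exact leadingCoeff_smul_of_smul_regular _ (IsSMulRegular.of_ne_zero hδ)
    · refine degree_C_le.trans_lt (natDegree_pos_iff_degree_pos.1 ?_)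
      rw [natDegree_smul _ hδ]
      exact Nat.pos_of_ne_zero hdeg

lemma degreeOf_aeval_X_le {σ A : Type*} [CommSemiring A] [Nontrivial A] (q : A[X]) (i : σ) :
    MvPolynomial.degreeOf i (aeval (MvPolynomial.X i : MvPolynomial σ A) q) ≤ q.natDegree := by
  rw [aeval_eq_sum_range]
  refine (MvPolynomial.degreeOf_sum_le _ _ _).trans (Finset.sup_le fun k hk => ?_)
  rw [MvPolynomial.smul_eq_C_mul]
  refine (MvPolynomial.degreeOf_C_mul_le _ _ _).trans ?_
  rw [MvPolynomial.degreeOf_X_self_pow]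
  exact Nat.lt_succ_iff.1 (Finset.mem_range.1 hk)

lemma degreeOf_perturb_le (hP : MvPolynomial.degreeOf 1 P ≤ R₀.natDegree) (δ : ℂ) :
    MvPolynomial.degreeOf 1 (perturb R₀ P δ) ≤ R₀.natDegree :=
  (MvPolynomial.degreeOf_add_le _ _ _).trans (max_le (degreeOf_aeval_X_le _ _)
    ((MvPolynomial.degreeOf_C_mul_le _ _ _).trans hP))

lemma eventually_degreeOf_perturb_eq (hP : MvPolynomial.degreeOf 1 P ≤ R₀.natDegree)
    (hR₀ : R₀ ≠ 0) :
    ∀ᶠ δ in 𝓝 (0 : ℂ), MvPolynomial.degreeOf 1 (perturb R₀ P δ) = R₀.natDegree := by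
  have hcont : Continuous fun δ : ℂ =>
      (R₀ + δ • fibre P ((0 : ℂ) : Sphere)).coeff R₀.natDegree := by
    simp only [coeff_add, coeff_smul]
    fun_prop
  filter_upwards [hcont.continuousAt.eventually_ne (by simpa using hR₀ : _ ≠ (0 : ℂ))] with δ hδ
  rw [← fibre_perturb_coe] at hδ
  exact (degreeOf_perturb_le hP δ).antisymm
    ((le_natDegree_of_ne_zero hδ).trans (natDegree_fibre_le _ _))

end Perturb

section PerturbedBranches

open Polynomial

variable {R₀ : ℂ[X]} {P : MvPolynomial (Fin 2) ℂ}

lemma eventually_forall_fibre_perturb_mem (Φ : ℂ[X] →ₗ[ℂ] ℂ)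
    (hΦ : Continuous fun z : ℂ => Φ (fibre P (z : Sphere))) {U : Set ℂ} (hU : IsOpen U)
    (h0 : Φ R₀ ∈ U) {K : Set ℂ} (hK : IsCompact K) :
    ∀ᶠ δ in 𝓝 (0 : ℂ), ∀ z ∈ K, Φ (fibre (perturb R₀ P δ) (z : Sphere)) ∈ U := by
  simp only [fibre_perturb_coe, map_add, map_smul]
  have hcont : Continuous fun x : ℂ × ℂ => Φ R₀ + x.1 • Φ (fibre P (x.2 : Sphere)) :=
    continuous_const.add (continuous_fst.smul (hΦ.comp continuous_snd))
  refine hK.eventually_forall_of_forall_eventually fun z _ => ?_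
  exact hcont.continuousAt.eventually_mem (hU.mem_nhds (by simpa using h0))

lemma exists_forall_norm_eval_sub_le_mul_dist (P : MvPolynomial (Fin 2) ℂ) {K K' : Set ℂ}
    (hK : IsCompact K) (hK' : IsCompact K') :
    ∃ L : ℝ, ∀ x ∈ K, ∀ y ∈ K, ∀ w ∈ K', ‖(fibre P (x : Sphere)).eval w -
      (fibre P (y : Sphere)).eval w‖ ≤ L * dist x y := by
  have hsmooth : ContDiff ℂ 1 fun p : ℂ × ℂ => MvPolynomial.eval ![p.1, p.2] P := by
    simp only [MvPolynomial.eval_eq', Fin.prod_univ_two, Matrix.cons_val_zero, Matrix.cons_val_one]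
    fun_prop
  obtain ⟨L, hL⟩ := (hsmooth.locallyLipschitz.locallyLipschitzOn).exists_lipschitzOnWith_of_compact
    (hK.prod hK')
  refine ⟨L, fun x hx y hy w hw => ?_⟩
  have hdist := hL.dist_le_mul (x, w) ⟨hx, hw⟩ (y, w) ⟨hy, hw⟩
  rwa [dist_eq_norm, ← eval_fibre_coe, ← eval_fibre_coe, Prod.dist_eq, dist_self,
    max_eq_left dist_nonneg] at hdist

lemma card_roots_toFinset_eq_natDegree
    (hsimple : ∀ u : ℂ, R₀.IsRoot u → R₀.rootMultiplicity u = 1) :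
    Fintype.card R₀.roots.toFinset = R₀.natDegree := by
  have hnodup : R₀.roots.Nodup := by
    refine Multiset.nodup_iff_count_le_one.2 fun u => ?_
    rw [count_roots]
    by_cases hu : R₀.IsRoot u
    · exact (hsimple u hu).le
    · simp [rootMultiplicity_eq_zero hu]
  rw [Fintype.card_coe, Multiset.toFinset_card_of_nodup hnodup,
    (IsAlgClosed.splits R₀).natDegree_eq_card_roots]

lemma eventually_forall_natDegree_eq_and_le_norm_leadingCoeff_fibre
    (hP : MvPolynomial.degreeOf 1 P ≤ R₀.natDegree) (hR₀ : R₀ ≠ 0) {K : Set ℂ} (hK : IsCompact K) :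
    ∀ᶠ δ in 𝓝 (0 : ℂ), ∀ z ∈ K,
      (fibre (perturb R₀ P δ) (z : Sphere)).natDegree = R₀.natDegree ∧
      ‖R₀.leadingCoeff‖ / 2 ≤ ‖(fibre (perturb R₀ P δ) (z : Sphere)).leadingCoeff‖ := by
  have hlc : 0 < ‖R₀.leadingCoeff‖ := norm_pos_iff.2 (leadingCoeff_ne_zero.2 hR₀)
  filter_upwards [eventually_forall_fibre_perturb_mem (R₀ := R₀) (lcoeff ℂ R₀.natDegree)
    (continuous_coeff_fibre P R₀.natDegree)
    (isOpen_lt continuous_const continuous_norm) (half_lt_self hlc) hK] with δ hδ z hz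
  have hcoeff : ‖R₀.leadingCoeff‖ / 2 <
      ‖(fibre (perturb R₀ P δ) (z : Sphere)).coeff R₀.natDegree‖ := hδ z hz
  have hdeg : (fibre (perturb R₀ P δ) (z : Sphere)).natDegree = R₀.natDegree :=
    natDegree_eq_of_le_of_coeff_ne_zero ((natDegree_fibre_le _ _).trans (degreeOf_perturb_le hP δ))
      (norm_pos_iff.1 ((half_pos hlc).trans hcoeff))
  exact ⟨hdeg, by simpa only [leadingCoeff, hdeg] using hcoeff.le⟩

lemma eventually_forall_norm_eval_fibre_perturb_lt {u : ℂ} (hu : R₀.IsRoot u) {c : ℝ}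
    (hc : 0 < c) {K : Set ℂ} (hK : IsCompact K) :
    ∀ᶠ δ in 𝓝 (0 : ℂ), ∀ z ∈ K, ‖(fibre (perturb R₀ P δ) (z : Sphere)).eval u‖ < c := by
  have hcont : Continuous fun z : ℂ => leval u (fibre P (z : Sphere)) := by
    simp only [leval_apply, eval_fibre_coe]
    exact (continuous_eval_pair P).comp (g := fun p : ℂ × ℂ => MvPolynomial.eval ![p.1, p.2] P)
      (f := fun z => (z, u)) (Continuous.prodMk_left u)
  have hball : leval u R₀ ∈ Metric.ball 0 c := by simpa [hu.eq_zero] using hc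
  filter_upwards [eventually_forall_fibre_perturb_mem _ hcont Metric.isOpen_ball hball hK]
    with δ hδ z hz
  exact mem_ball_zero_iff.1 (hδ z hz)

lemma eventually_exists_lipschitzWith_roots_fibre_perturb_eq
    (hsimple : ∀ u : ℂ, R₀.IsRoot u → R₀.rootMultiplicity u = 1)
    (hP : MvPolynomial.degreeOf 1 P ≤ R₀.natDegree) (hR₀ : R₀ ≠ 0) {K : Set ℂ} (hK : IsCompact K)
    {κ : NNReal} (hκ : 0 < κ) {ε : ℝ} (hε : 0 < ε) :
    ∀ᶠ δ in 𝓝 (0 : ℂ), ∃ g : R₀.roots.toFinset → K → ℂ, (∀ i, LipschitzWith κ (g i)) ∧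
      (∀ i x, dist (g i x) i < ε) ∧ ∀ x : K,
        (fibre (perturb R₀ P δ) (x : ℂ)).roots = Finset.univ.val.map fun i => g i x := by
  have hcard := card_roots_toFinset_eq_natDegree hsimple
  set ℓ := ‖R₀.leadingCoeff‖ / 2
  have hℓ : 0 < ℓ := half_pos (norm_pos_iff.2 (leadingCoeff_ne_zero.2 hR₀))
  obtain ⟨r, hsep, hr, hrε⟩ := ((eventually_pairwise_mul_le_dist
    (c := ((↑) : R₀.roots.toFinset → ℂ)) Subtype.val_injective 4).and
      (Ioo_mem_nhdsGT hε)).exists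
  obtain ⟨L, hL⟩ := exists_forall_norm_eval_sub_le_mul_dist P hK
    (isCompact_iUnion fun i : R₀.roots.toFinset => isCompact_closedBall (i : ℂ) r)
  have hsmall : ∀ᶠ δ in 𝓝 (0 : ℂ),
      ‖δ‖ * L < ℓ * (2 * r) ^ (Fintype.card R₀.roots.toFinset - 1) * κ := by
    have hcont : Continuous fun δ : ℂ => ‖δ‖ * L := by fun_prop
    refine hcont.continuousAt.eventually_lt_const ?_
    simp only [norm_zero, zero_mul]
    positivity
  have heval : ∀ᶠ δ in 𝓝 (0 : ℂ), ∀ i : R₀.roots.toFinset, ∀ z ∈ K,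
      ‖(fibre (perturb R₀ P δ) (z : Sphere)).eval (i : ℂ)‖ <
        ℓ * r ^ Fintype.card R₀.roots.toFinset :=
    eventually_all.2 fun i => eventually_forall_norm_eval_fibre_perturb_lt
      (mem_roots'.1 (Multiset.mem_toFinset.1 i.2)).2 (by positivity) hK
  filter_upwards [eventually_forall_natDegree_eq_and_le_norm_leadingCoeff_fibre hP hR₀ hK,
    hsmall, heval]
    with δ hdeg hδL heval
  have hlip : ∀ (x y : K) (i : R₀.roots.toFinset), ∀ w ∈ Metric.ball (i : ℂ) r,
      ‖(fibre (perturb R₀ P δ) (x : ℂ)).eval w - (fibre (perturb R₀ P δ) (y : ℂ)).eval w‖ ≤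
        ℓ * (2 * r) ^ (Fintype.card R₀.roots.toFinset - 1) * (κ * dist x y) := by
    intro x y i w hw
    have hxy := hL x x.2 y y.2 w (Set.mem_iUnion.2 ⟨i, Metric.ball_subset_closedBall hw⟩)
    simp only [fibre_perturb_coe, eval_add, eval_smul, add_sub_add_left_eq_sub, ← smul_sub,
      norm_smul]
    calc _ ≤ ‖δ‖ * (L * dist (x : ℂ) y) := by gcongr
      _ = ‖δ‖ * L * dist x y := (mul_assoc _ _ _).symm
      _ ≤ ℓ * (2 * r) ^ (Fintype.card R₀.roots.toFinset - 1) * κ * dist x y := by gcongr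
      _ = _ := mul_assoc _ _ _
  obtain ⟨g, hg, hdist, hroots⟩ := exists_lipschitzWith_roots_eq_map
    (fun x : K => (hdeg x x.2).1.trans hcard.symm) hℓ (fun x => (hdeg x x.2).2) hr hsep
    (fun x i => heval i x x.2) hlip
  exact ⟨g, hg, fun i x => (hdist i x).trans hrε, hroots⟩

end PerturbedBranches

section Absorption

open Polynomial

variable {R₀ : ℂ[X]} {P : MvPolynomial (Fin 2) ℂ}

lemma natDegree_smul_add_smul_ne_zero {K : Type*} [Field K] {p q : K[X]}
    (h : LinearIndependent K ![1, p, q]) {v : K × K} (hv : v ≠ 0) :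
    (v.1 • p + v.2 • q).natDegree ≠ 0 := by
  intro h0
  have hconst := eq_C_of_natDegree_eq_zero h0
  have hzero := Fintype.linearIndependent_iff.1 h ![-(v.1 • p + v.2 • q).coeff 0, v.1, v.2] (by
    rw [Fin.sum_univ_three]
    simp only [Matrix.cons_val]
    rw [add_assoc, hconst]
    simp [smul_eq_C_mul])
  exact hv (Prod.ext (hzero 1) (hzero 2))

lemma eventually_cobounded_forall_exists_norm_coeff_fibre_perturb_sub_le (R₀ : ℂ[X])
    (P : MvPolynomial (Fin 2) ℂ) (d : ℕ) {η : ℝ} (hη : 0 < η) :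
    ∀ᶠ z : ℂ in Bornology.cobounded ℂ, ∀ δ : ℂ, ∃ v : ℂ × ℂ, v ≠ 0 ∧ ∀ k ≤ d,
      ‖(fibre (perturb R₀ P δ) (z : Sphere)).coeff k -
        (v.1 • R₀ + v.2 • fibre P OnePoint.infty).coeff k‖ ≤ η * ‖v‖ := by
  filter_upwards [eventually_cobounded_norm_coeff_fibre_sub_le P d hη] with z hz δ
  set s := z ^ (collectZ P).natDegree
  refine ⟨(1, δ * s), by simp, fun k hk => ?_⟩
  have hdiff : (fibre (perturb R₀ P δ) (z : Sphere)).coeff k -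
      ((1 : ℂ) • R₀ + (δ * s) • fibre P OnePoint.infty).coeff k =
      δ * ((fibre P (z : Sphere)).coeff k - s * (fibre P OnePoint.infty).coeff k) := by
    simp only [fibre_perturb_coe, coeff_add, coeff_smul, smul_eq_mul]
    ring
  calc _ ≤ ‖δ‖ * (η * ‖s‖) := by
        rw [hdiff, norm_mul]
        gcongr
        exact hz k hk
    _ = η * ‖δ * s‖ := by rw [norm_mul]; ring
    _ ≤ η * ‖((1, δ * s) : ℂ × ℂ)‖ := by
        gcongr
        exact norm_snd_le ((1, δ * s) : ℂ × ℂ)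

lemma eventually_forall_exists_discIncl_mem_images
    (hP : MvPolynomial.degreeOf 1 P ≤ R₀.natDegree)
    (hlin : LinearIndependent ℂ ![1, R₀, fibre P OnePoint.infty]) :
    ∀ᶠ ρ in atTop, ∀ (δ : ℂ), ∀ a ∉ Set.range (discIncl ρ), ∃ x,
      discIncl ρ x ∈ images (perturb R₀ P δ) a := by
  let L : ℂ × ℂ →ₗ[ℂ] ℂ[X] := (LinearMap.toSpanSingleton ℂ ℂ[X] R₀).coprod
    (LinearMap.toSpanSingleton ℂ ℂ[X] (fibre P OnePoint.infty))
  obtain ⟨η, hη, hroot⟩ := exists_eventually_exists_mem_roots_norm_lt L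
    (fun v => natDegree_add_le_of_degree_le (natDegree_smul_le _ _)
      ((natDegree_smul_le _ _).trans ((natDegree_fibre_le P _).trans hP)))
    fun v hv => natDegree_smul_add_smul_ne_zero hlin hv
  obtain ⟨ρ₀, -, hfar⟩ := (Metric.hasBasis_cobounded_compl_closedBall (0 : ℂ)).eventually_iff.1
    (eventually_cobounded_forall_exists_norm_coeff_fibre_perturb_sub_le R₀ P R₀.natDegree hη)
  filter_upwards [hroot, eventually_ge_atTop ρ₀] with ρ hroot hρ δ a ha
  have hnear : ∃ v ≠ 0, ∀ k ≤ R₀.natDegree,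
      ‖(fibre (perturb R₀ P δ) a).coeff k - (L v).coeff k‖ ≤ η * ‖v‖ := by
    induction a using OnePoint.rec with
    | infty =>
      obtain ⟨v, hv, hfibre⟩ := exists_fibre_perturb_infty_eq R₀ P δ
      have hL : fibre (perturb R₀ P δ) OnePoint.infty = L v := hfibre
      exact ⟨v, hv, fun k _ => by rw [hL, sub_self, norm_zero]; positivity⟩
    | coe z =>
      exact hfar (fun hz => ha ⟨⟨z, Metric.closedBall_subset_closedBall hρ hz⟩, rfl⟩) δ
  obtain ⟨v, hv, hcoeff⟩ := hnear
  obtain ⟨w, hw, hwρ⟩ :=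
    hroot v hv _ ((natDegree_fibre_le _ a).trans (degreeOf_perturb_le hP δ)) hcoeff
  exact ⟨⟨w, mem_closedBall_zero_iff.2 hwρ.le⟩, coe_mem_images_iff.2 hw⟩

end Absorption

section PerturbedCorrespondence

open Polynomial

variable {R₀ : ℂ[X]} {P : MvPolynomial (Fin 2) ℂ}

lemma images_eq_map_roots {R : MvPolynomial (Fin 2) ℂ} {a : Sphere}
    (h : (fibre R a).natDegree = MvPolynomial.degreeOf 1 R) :
    images R a = (fibre R a).roots.map (↑) := by
  rw [images, h, Nat.sub_self, Multiset.replicate_zero, add_zero]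

lemma nonempty_roots_of_linearIndependent {q : ℂ[X]} (hlin : LinearIndependent ℂ ![1, R₀, q]) :
    Nonempty R₀.roots.toFinset := by
  have hdeg : R₀.natDegree ≠ 0 := by
    simpa using natDegree_smul_add_smul_ne_zero hlin (v := (1, 0)) (by simp)
  obtain ⟨u, hu⟩ := IsAlgClosed.exists_root R₀ fun h => hdeg (natDegree_eq_of_degree_eq_some h)
  exact ⟨u, Multiset.mem_toFinset.2 ((mem_roots (hlin.ne_zero 1)).2 hu)⟩

lemma exists_eventually_hasBranches_perturb
    (hsimple : ∀ u : ℂ, R₀.IsRoot u → R₀.rootMultiplicity u = 1)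
    (hP : MvPolynomial.degreeOf 1 P ≤ R₀.natDegree)
    (hlin : LinearIndependent ℂ ![1, R₀, fibre P OnePoint.infty])
    {κ : NNReal} (hκ : 0 < κ) {ε : ℝ} (hε : 0 < ε) :
    ∃ ρ : ℝ, ∀ᶠ δ in 𝓝 (0 : ℂ),
      ∃ f : R₀.roots.toFinset → Metric.closedBall (0 : ℂ) ρ → Metric.closedBall (0 : ℂ) ρ,
        HasBranches (images (perturb R₀ P δ)) (discIncl ρ) f ∧ (∀ i, LipschitzWith κ (f i)) ∧
        ∀ i x, ‖(f i x : ℂ)‖ < ρ ∧ dist (f i x : ℂ) i < ε := by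
  have hR₀ : R₀ ≠ 0 := hlin.ne_zero 1
  obtain ⟨i₀⟩ := nonempty_roots_of_linearIndependent hlin
  have hroots : ∀ᶠ ρ : ℝ in atTop, ∀ i : R₀.roots.toFinset, ‖(i : ℂ)‖ + 1 ≤ ρ :=
    eventually_all.2 fun i => eventually_ge_atTop _
  obtain ⟨ρ, hmem, hρ⟩ := ((eventually_forall_exists_discIncl_mem_images hP hlin).and hroots).exists
  refine ⟨ρ, ?_⟩
  filter_upwards [eventually_degreeOf_perturb_eq hP hR₀,
    eventually_forall_natDegree_eq_and_le_norm_leadingCoeff_fibre hP hR₀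
      (isCompact_closedBall (0 : ℂ) ρ),
    eventually_exists_lipschitzWith_roots_fibre_perturb_eq hsimple hP hR₀
      (isCompact_closedBall (0 : ℂ) ρ) hκ (lt_min hε one_pos)]
    with δ hdeg hfibre ⟨g, hg, hdist, hgr⟩
  have hlt : ∀ i x, ‖g i x‖ < ρ := fun i x => by
    have hnear := norm_le_norm_add_norm_sub' (g i x) i
    rw [← dist_eq_norm] at hnear
    linarith [hρ i, (lt_min_iff.1 (hdist i x)).2]
  let f : R₀.roots.toFinset → Metric.closedBall (0 : ℂ) ρ → Metric.closedBall (0 : ℂ) ρ :=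
    fun i x => ⟨g i x, mem_closedBall_zero_iff.2 (hlt i x).le⟩
  have happly : ∀ x, images (perturb R₀ P δ) (discIncl ρ x) = (branches f x).map (discIncl ρ) := by
    intro x
    change images (perturb R₀ P δ) ((x : ℂ) : Sphere) = _
    rw [images_eq_map_roots ((hfibre x x.2).1.trans hdeg.symm), hgr x, branches, Multiset.map_map,
      Multiset.map_map]
    rfl
  refine ⟨f, ⟨happly, fun a => ?_, fun a => ?_⟩, hg, fun i x =>
    ⟨hlt i x, (lt_min_iff.1 (hdist i x)).1⟩⟩
  · rw [card_images, hdeg, card_roots_toFinset_eq_natDegree hsimple]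
  · by_cases ha : a ∈ Set.range (discIncl ρ)
    · obtain ⟨x, rfl⟩ := ha
      exact ⟨f i₀ x, happly x ▸ Multiset.mem_map_of_mem _ (mem_branches.2 ⟨i₀, rfl⟩)⟩
    · exact hmem δ a ha

end PerturbedCorrespondence

section DiagonalExpansion

open Polynomial

lemma natDegree_C_X_sub_X_le (A : Type*) [CommRing A] : (C X - X : A[X][X]).natDegree ≤ 1 := by
  compute_degree

lemma natDegree_C_X_sub_X_pow_le (A : Type*) [CommRing A] (n : ℕ) :
    ((C X - X : A[X][X]) ^ n).natDegree ≤ n :=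
  (natDegree_pow_le_of_le n (natDegree_C_X_sub_X_le A)).trans_eq (mul_one n)

lemma coeff_C_X_sub_X_pow_self (A : Type*) [CommRing A] (n : ℕ) :
    ((C X - X : A[X][X]) ^ n).coeff n = (-1) ^ n := by
  simpa using coeff_pow_of_natDegree_le (m := n) (natDegree_C_X_sub_X_le A)

lemma collectZ_sum_aeval_mul_pow (d : ℕ) (Q : ℕ → ℂ[X]) :
    collectZ (∑ i ∈ Finset.range (d + 1), aeval (MvPolynomial.X 1) (Q i) *
      (MvPolynomial.X 1 - MvPolynomial.X 0) ^ (d - i)) =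
    ∑ i ∈ Finset.range (d + 1), C (Q i) * (C X - X) ^ (d - i) := by
  simp only [← collectZ_aeval_X_one]
  simp [collectZ]

lemma leadingCoeff_sum_C_mul_C_X_sub_X_pow {A : Type*} [CommRing A] {d j : ℕ} {Q : ℕ → A[X]}
    (hj : j ≤ d)
    (hne : Q j ≠ 0) (hmin : ∀ i < j, Q i = 0) :
    (∑ i ∈ Finset.range (d + 1), C (Q i) * (C X - X) ^ (d - i)).leadingCoeff =
      (-1) ^ (d - j) * Q j := by
  have hdeg : (∑ i ∈ Finset.range (d + 1), C (Q i) * (C X - X) ^ (d - i)).natDegree ≤ d - j := by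
    refine natDegree_sum_le_of_forall_le _ _ fun i _ => ?_
    rcases lt_or_ge i j with hi | hi
    · simp [hmin i hi]
    · exact (natDegree_C_mul_le _ _).trans ((natDegree_C_X_sub_X_pow_le _ _).trans (by omega))
  have hcoeff : (∑ i ∈ Finset.range (d + 1), C (Q i) * (C X - X) ^ (d - i)).coeff (d - j) =
      (-1) ^ (d - j) * Q j := by
    rw [finsetSum_coeff, Finset.sum_eq_single_of_mem j (Finset.mem_range.2 (by omega)),
      coeff_C_mul, coeff_C_X_sub_X_pow_self, mul_comm]
    intro i hi hij
    rcases lt_or_ge i j with hlt | hge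
    · simp [hmin i hlt]
    · have hid := Finset.mem_range.1 hi
      rw [coeff_C_mul, coeff_eq_zero_of_natDegree_lt
        ((natDegree_C_X_sub_X_pow_le _ _).trans_lt (by omega)), mul_zero]
  have hunit : IsUnit ((-1 : A[X]) ^ (d - j)) := isUnit_neg_one.pow _
  rw [leadingCoeff, natDegree_eq_of_le_of_coeff_ne_zero hdeg
    (by rwa [hcoeff, Ne, hunit.mul_right_eq_zero]), hcoeff]

lemma natDegree_fibre_infty_sum_aeval_mul_pow {d j : ℕ} {Q : ℕ → ℂ[X]} (hj : j ≤ d)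
    (hne : Q j ≠ 0) (hmin : ∀ i < j, Q i = 0) :
    (fibre (∑ i ∈ Finset.range (d + 1), aeval (MvPolynomial.X 1) (Q i) *
      (MvPolynomial.X 1 - MvPolynomial.X 0) ^ (d - i)) OnePoint.infty).natDegree =
      (Q j).natDegree := by
  change (collectZ _).leadingCoeff.natDegree = _
  rw [collectZ_sum_aeval_mul_pow, leadingCoeff_sum_C_mul_C_X_sub_X_pow hj hne hmin]
  rcases neg_one_pow_eq_or ℂ[X] (d - j) with h | h <;> simp [h]

lemma linearIndependent_of_injective_degree {K ι : Type*} [Field K] {p : ι → K[X]}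
    (hne : ∀ i, p i ≠ 0) (hinj : Function.Injective fun i => (p i).degree) :
    LinearIndependent K p := by
  refine linearIndependent_iff'.2 fun s c hsum i hi => by_contra fun hci => hne i ?_
  have hsup := degree_sum_eq_of_disjoint (fun k => c k • p k) s fun k hk l hl hkl => by
    simp only [Function.onFun, Function.comp_apply, Set.mem_ofPred_eq, smul_ne_zero_iff] at hk hl ⊢
    rw [degree_smul_of_smul_regular _ (IsSMulRegular.of_ne_zero hk.2.1),
      degree_smul_of_smul_regular _ (IsSMulRegular.of_ne_zero hl.2.1)]
    exact hinj.ne hkl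
  rw [hsum, degree_zero, eq_comm, Finset.sup_eq_bot_iff] at hsup
  exact (smul_eq_zero.1 (degree_eq_bot.1 (hsup i hi))).resolve_left hci

lemma linearIndependent_one_of_natDegree_lt {K : Type*} [Field K] {p q : K[X]}
    (hq : q.natDegree ≠ 0) (hqp : q.natDegree < p.natDegree) :
    LinearIndependent K ![1, p, q] := by
  have hp0 : p ≠ 0 := ne_zero_of_natDegree_gt hqp
  have hq0 : q ≠ 0 := ne_zero_of_natDegree_gt (Nat.pos_of_ne_zero hq)
  refine linearIndependent_of_injective_degree (by simp [Fin.forall_fin_succ, hp0, hq0])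
    fun i k hik => ?_
  have hik' := natDegree_eq_natDegree hik
  fin_cases i <;> fin_cases k <;> simp at hik' ⊢ <;> omega

end DiagonalExpansion

end HolCorr

end

theorem mainTheorem3_general (R₀ : Polynomial ℂ)
    (hsimple : ∀ u : ℂ, R₀.IsRoot u → R₀.rootMultiplicity u = 1)
    (P : MvPolynomial (Fin 2) ℂ) (hP : MvPolynomial.degreeOf 1 P ≤ R₀.natDegree)
    (hlin : LinearIndependent ℂ ![1, R₀, HolCorr.fibre P OnePoint.infty])
    (ε : ℝ) (hε : 0 < ε) :
    ∃ Δ : ℝ, 0 < Δ ∧ ∀ δ : ℂ, ‖δ‖ < Δ →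
      ∃ μ : MeasureTheory.Measure HolCorr.Sphere, MeasureTheory.IsProbabilityMeasure μ ∧ μ.Regular ∧
        HolCorr.pushforward (HolCorr.images (HolCorr.perturb R₀ P δ)) μ =
          (R₀.natDegree : ENNReal) • μ ∧
        (∀ a : HolCorr.Sphere, HolCorr.WeakStarTendsto
          (fun m => ((R₀.natDegree : ENNReal) ^ m)⁻¹ •
            HolCorr.pushforward (HolCorr.iter (HolCorr.images (HolCorr.perturb R₀ P δ)) m)
              (MeasureTheory.Measure.dirac a)) μ) ∧
        μ.support ⊆ (fun w : ℂ => (w : HolCorr.Sphere)) ''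
          Metric.thickening ε {u : ℂ | R₀.IsRoot u} ∧
        IsLeast {S : Set HolCorr.Sphere | S.Nonempty ∧ IsClosed S ∧
          HolCorr.ForwardInvariant (HolCorr.perturb R₀ P δ) S} μ.support := by
  obtain ⟨ρ, hbranches⟩ :=
    HolCorr.exists_eventually_hasBranches_perturb hsimple hP hlin (κ := 2⁻¹) (by norm_num) hε
  obtain ⟨Δ, hΔ, hball⟩ := Metric.eventually_nhds_iff.1 hbranches
  refine ⟨Δ, hΔ, fun δ hδ => ?_⟩
  obtain ⟨f, hf, hlip, hnear⟩ := hball (by simpa using hδ)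
  obtain ⟨μ, hμ, hpush, hlim, hsupp, hleast⟩ := HolCorr.exists_equilibriumMeasure hf
    (by norm_num) hlip fun i x => (hnear i x).1
  rw [HolCorr.card_roots_toFinset_eq_natDegree hsimple] at hpush hlim
  refine ⟨μ, hμ, inferInstance, hpush, hlim, hsupp.trans (Set.iUnion_subset fun i => ?_), hleast⟩
  rintro _ ⟨x, rfl⟩
  have hroot := (Polynomial.mem_roots'.1 (Multiset.mem_toFinset.1 i.2)).2
  exact ⟨f i x, Metric.mem_thickening_iff.2 ⟨i, hroot, (hnear i x).2⟩, rfl⟩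

theorem mainTheorem3 (d : ℕ) (R₀ : Polynomial ℂ) (hdeg : R₀.natDegree = d)
    (hsimple : ∀ u : ℂ, R₀.IsRoot u → R₀.rootMultiplicity u = 1)
    (P : MvPolynomial (Fin 2) ℂ) (hP : P.totalDegree ≤ d)
    (Q : ℕ → Polynomial ℂ) (hQdeg : ∀ i ≤ d, (Q i).natDegree ≤ i)
    (hPQ : P = ∑ i ∈ Finset.range (d + 1),
      Polynomial.aeval (MvPolynomial.X 1) (Q i) *
        (MvPolynomial.X 1 - MvPolynomial.X 0) ^ (d - i))
    (j : ℕ) (hj : j < d) (hjne : Q j ≠ 0) (hjmin : ∀ i < j, Q i = 0)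
    (hjconst : ¬ ∃ c : ℂ, Q j = Polynomial.C c)
    (ε : ℝ) (hε : 0 < ε) :
    ∃ Δ : ℝ, 0 < Δ ∧ ∀ δ : ℂ, ‖δ‖ < Δ →
      ∃ μ : MeasureTheory.Measure HolCorr.Sphere, MeasureTheory.IsProbabilityMeasure μ ∧ μ.Regular ∧
        HolCorr.pushforward (HolCorr.images (HolCorr.perturb R₀ P δ)) μ = (d : ENNReal) • μ ∧
        (∀ a : HolCorr.Sphere, HolCorr.WeakStarTendsto
          (fun m => ((d : ENNReal) ^ m)⁻¹ •
            HolCorr.pushforward (HolCorr.iter (HolCorr.images (HolCorr.perturb R₀ P δ)) m)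
              (MeasureTheory.Measure.dirac a)) μ) ∧
        μ.support ⊆ (fun w : ℂ => (w : HolCorr.Sphere)) ''
          Metric.thickening ε {u : ℂ | R₀.IsRoot u} ∧
        IsLeast {S : Set HolCorr.Sphere | S.Nonempty ∧ IsClosed S ∧
          HolCorr.ForwardInvariant (HolCorr.perturb R₀ P δ) S} μ.support := by
  subst hdeg
  have hlin : LinearIndependent ℂ ![1, R₀, HolCorr.fibre P OnePoint.infty] := by
    have hfibre := hPQ ▸ HolCorr.natDegree_fibre_infty_sum_aeval_mul_pow hj.le hjne hjmin
    refine HolCorr.linearIndependent_one_of_natDegree_lt (fun h0 => hjconst ?_) ?_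
    · exact ⟨_, Polynomial.eq_C_of_natDegree_eq_zero (hfibre.symm.trans h0)⟩
    · exact hfibre.trans_lt ((hQdeg j hj.le).trans_lt hj)
  exact mainTheorem3_general R₀ hsimple P ((MvPolynomial.degreeOf_le_totalDegree P 1).trans hP)
    hlin ε hε
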